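/- Let $X$ be a finite regular CW complex (each attaching map is a homeomorphism onto its image); write $x\subseteq y$ when the closed cell $x$ is contained in the closed cell $y$, and $x<y$ when the containment is strict. Let $f\colon X\to\mathbb{R}$ be a discrete Morse function: $f$ assigns a real number to each cell so that for each $k$-cell $x$ there is at most one $(k+1)$-cell $y\supseteq x$ with $f(x)\ge f(y)$ and at most one $(k-1)$-cell $y\subseteq x$ with $f(y)\ge f(x)$. A pair $\{x,y\}$ with $x\subseteq y$, $\dim y=\dim x+1$ and $f(x)\ge f(y)$ is called regular, and a cell is critical if it lies in no regular pair. The entrance path category $\mathrm{Ent}[X]$ has the cells as objects; its morphisms $x\to y$ are the strictly descending sequences $(x=x_0>x_1>\dots>x_m=y)$, composed by concatenation; $g\Rightarrow g'$ means that $g$ is a (not necessarily contiguous) subsequence of $g'$. Let $\Sigma$ be the set of all morphisms $(y>x)$ with $\{x,y\}$ a regular pair, and $\Sigma^+$ its union with all identities. For cells $w,z$ consider zigzags $$w=x_0\xrightarrow{g_0}y_0\xleftarrow{f_0}x_1\xrightarrow{g_1}\cdots\xleftarrow{f_{k-1}}x_k\xrightarrow{g_k}y_k=z\qquad(k\ge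 0)$$ in $\mathrm{Ent}[X]$ with the $g_i$ arbitrary and the $f_i$ in $\Sigma^+$. In the localization $\mathrm{Loc}_\Sigma[X]$, the morphisms $w\to z$ are the classes of such zigzags for the equivalence relation generated by (a) replacing a segment $x_i\xrightarrow{g_i}y_i\xleftarrow{\mathrm{id}}y_i\xrightarrow{g_{i+1}}y_{i+1}$ by $x_i\xrightarrow{g_{i+1}\circ g_i}y_{i+1}$, and (b) relating two zigzags of the same length that are the rows of a commutative diagram whose vertical maps lie in $\Sigma^+$ and are identities at $w$ and at $z$. Composition is concatenation of zigzags, and $[\gamma]\Rightarrow[\gamma']$ holds if and only if there are representatives of $[\gamma']$ and $[\gamma]$ that are the top and bottom row, respectively, of a diagram with downward vertical maps in $\Sigma^+$, identities at $w$ and at $z$, such that in each square the composite through the bottom row is $\Rightarrow$ the composite through the top row. The discrete flow category $\mathrm{Flo}_\Sigma[X]$ is the full subcategory of $\mathrm{Loc}_\Sigma[X]$ on the critical cells. Theorem. Let $w,z$ be critical cells, let $[\gamma],[\gamma']\in\mathrm{Hom}_{\mathrm{Flo}_\Sigma[X]}(w,z)$ satisfy $[\gamma]\Rightarrow[\gamma']$,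 and let $$\tau=\left(w=x_0\xrightarrow{g_0}y_0\xleftarrow{f_0}x_1\xrightarrow{g_1}\cdots\xleftarrow{f_{k-1}}x_k\xrightarrow{g_k}y_k=z\right)$$ be any representative of $[\gamma]$. Then there are morphisms $g_i'\colon x_i\to y_i$ of $\mathrm{Ent}[X]$ with $g_i\Rightarrow g_i'$ for all $i$ such that $$\tau'=\left(w=x_0\xrightarrow{g_0'}y_0\xleftarrow{f_0}x_1\xrightarrow{g_1'}\cdots\xleftarrow{f_{k-1}}x_k\xrightarrow{g_k'}y_k=z\right)$$ represents $[\gamma']$. Furthermore, the $g_i'$ are unique: any family of morphisms $g_i''\colon x_i\to y_i$ for which the zigzag obtained from $\tau$ by replacing each $g_i$ with $g_i''$ represents $[\gamma']$ satisfies $g_i''=g_i'$ for all $i$. -/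

import Mathlib

open CategoryTheory

universe v u

/-! ### p-categories and their localization -/

/-- A p-category: a category enriched in posets. The relation `g ≤ g'` on morphisms is written
`g ⇒ g'` in the literature on discrete flow categories. -/
class PCategory (C : Type u) extends Category.{v} C where
  /-- the partial order on each set of morphisms -/
  homOrder (x y : C) : PartialOrder (x ⟶ y)
  /-- composition is monotone -/
  comp_mono {x y z : C} {g g' : x ⟶ y} {f f' : y ⟶ z} :
    g ≤ g' → f ≤ f' → g ≫ f ≤ g' ≫ f'

instance {C : Type u} [PCategory.{v} C] (x y : C) : PartialOrder (x ⟶ y) :=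
  PCategory.homOrder x y

namespace PLoc

variable {C : Type u} [PCategory.{v} C]

/-- `Plus S` is the union of the collection `S` with all identities. -/
inductive Plus (S : MorphismProperty C) : ∀ {x y : C}, (x ⟶ y) → Prop
  | of {x y : C} {f : x ⟶ y} (hf : S f) : Plus S f
  | id (x : C) : Plus S (𝟙 x)

/-- Zigzags `w ⟶ y₀ ⟵ x₁ ⟶ y₁ ⟵ ⋯ ⟵ x_k ⟶ y_k = z` with `k ≥ 0`, forward maps `g_i` arbitrary
and backward maps `f_i` in `S` or identities. `cons g f hf r` is `w ⟶ y ⟵ x` followed by the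
zigzag `r` from `x` to `z`. -/
inductive Zigzag (S : MorphismProperty C) : C → C → Type (max u v)
  | single {w z : C} (g : w ⟶ z) : Zigzag S w z
  | cons {w y x z : C} (g : w ⟶ y) (f : x ⟶ y) (hf : Plus S f) (r : Zigzag S x z) : Zigzag S w z

namespace Zigzag

variable {S : MorphismProperty C}

/-- Composing the first forward map of a zigzag with a morphism. -/
def precomp {v w z : C} (h : v ⟶ w) : Zigzag S w z → Zigzag S v z
  | single g => single (h ≫ g)
  | cons g f hf r => cons (h ≫ g) f hf r

/-- Concatenation of zigzags: the last forward map of the first one is composed with the first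
forward map of the second one. -/
def comp {w x z : C} : Zigzag S w x → Zigzag S x z → Zigzag S w z
  | single g, s => precomp g s
  | cons g f hf r, s => cons g f hf (comp r s)

/-- `Horizontal τ τ'`: `τ'` is obtained from `τ` by removing one intermediate identity, i.e. by
replacing a segment `x ⟶ y ⟵ y ⟶ y'` with middle map `𝟙 y` by the composite `x ⟶ y'`. -/
inductive Horizontal : ∀ {w z : C}, Zigzag S w z → Zigzag S w z → Prop
  | remove {w y z : C} (g : w ⟶ y) (hid : Plus S (𝟙 y)) (r : Zigzag S y z) :
      Horizontal (cons g (𝟙 y) hid r) (precomp g r)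
  | tail {w y x z : C} (g : w ⟶ y) (f : x ⟶ y) (hf : Plus S f) {r r' : Zigzag S x z} :
      Horizontal r r' → Horizontal (cons g f hf r) (cons g f hf r')

/-- `Ladder R v τ τ'`: the zigzags `τ` and `τ'` are the top and bottom row of a diagram
```
  x  --g-->  y  <--f--  x₁  --> ⋯ <-- x_k  --> z
  |v         |u         |v₁           |v_k     |𝟙
  x' --g'--> y' <--f'-- x₁' --> ⋯ <-- x_k' --> z
```
whose leftmost vertical map is `v`, whose other vertical maps lie in `Plus S`, the rightmost one
being the identity, and such that in each square
`R (path through the bottom row) (path through the top row)` holds. -/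
inductive Ladder (R : ∀ ⦃a b : C⦄, (a ⟶ b) → (a ⟶ b) → Prop) :
    ∀ {x x' z : C}, (x ⟶ x') → Zigzag S x z → Zigzag S x' z → Prop
  | single {x x' z : C} {v : x ⟶ x'} {g : x ⟶ z} {g' : x' ⟶ z} :
      R (v ≫ g') g → Ladder R v (single g) (single g')
  | cons {x y x₁ x' y' x₁' z : C} {v : x ⟶ x'} {u : y ⟶ y'} {v₁ : x₁ ⟶ x₁'}
      {g : x ⟶ y} {f : x₁ ⟶ y} {hf : Plus S f} {r : Zigzag S x₁ z}
      {g' : x' ⟶ y'} {f' : x₁' ⟶ y'} {hf' : Plus S f'} {r' : Zigzag S x₁' z} :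
      Plus S u → Plus S v₁ → R (v ≫ g') (g ≫ u) → R (v₁ ≫ f') (f ≫ u) →
      Ladder R v₁ r r' → Ladder R v (cons g f hf r) (cons g' f' hf' r')

/-- `τ` and `τ'` are the top and bottom row of a commutative diagram. -/
def Vertical {w z : C} (τ τ' : Zigzag S w z) : Prop :=
  Ladder (fun _ _ a b => a = b) (𝟙 w) τ τ'

/-- `τ` and `τ'` are the top and bottom row of a diagram in which each path through the bottom row
is `≤` the corresponding path through the top row. -/
def OrderDiagram {w z : C} (τ τ' : Zigzag S w z) : Prop :=
  Ladder (fun _ _ a b => a ≤ b) (𝟙 w) τ τ'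

/-- The horizontal and vertical relations; they generate the equivalence of zigzags. -/
def Rel {w z : C} (τ τ' : Zigzag S w z) : Prop := Horizontal τ τ' ∨ Vertical τ τ'

/-- A choice `(g_i')` of morphisms `g_i' : x_i ⟶ y_i`, one for each forward map `g_i : x_i ⟶ y_i`
of the zigzag. -/
def ForwardMaps {w z : C} : Zigzag S w z → Type v
  | @single _ _ _ w z _ => (w ⟶ z)
  | @cons _ _ _ w y _ _ _ _ _ r => (w ⟶ y) × ForwardMaps r

/-- The zigzag with the same objects and the same backward maps, whose forward maps `g_i` are
replaced with the given `g_i'`. -/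
def replaceForward {w z : C} : (τ : Zigzag S w z) → τ.ForwardMaps → Zigzag S w z
  | single _, g' => single g'
  | cons _ f hf r, g' => cons g'.1 f hf (replaceForward r g'.2)

/-- `g_i ≤ g_i'` for every forward map `g_i` of the zigzag. -/
def ForwardLE {w z : C} : (τ : Zigzag S w z) → τ.ForwardMaps → Prop
  | single g, g' => g ≤ g'
  | cons g _ _ r, g' => g ≤ g'.1 ∧ ForwardLE r g'.2

lemma precomp_id {w z : C} (τ : Zigzag S w z) : precomp (𝟙 w) τ = τ := by
  cases τ <;> simp [precomp]

lemma precomp_precomp {a b w z : C} (h : a ⟶ b) (k : b ⟶ w) (τ : Zigzag S w z) :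
    precomp h (precomp k τ) = precomp (h ≫ k) τ := by
  cases τ <;> simp [precomp]

lemma precomp_comp {a w x z : C} (h : a ⟶ w) (τ : Zigzag S w x) (σ : Zigzag S x z) :
    comp (precomp h τ) σ = precomp h (comp τ σ) := by
  cases τ with
  | single g => exact (precomp_precomp h g σ).symm
  | cons g f hf r => rfl

lemma comp_single_id {w z : C} (τ : Zigzag S w z) : comp τ (single (𝟙 z)) = τ := by
  induction τ with
  | single g => simp [comp, precomp]
  | cons g f hf r ih => simp [comp, ih]

lemma comp_assoc {a b c d : C} (τ : Zigzag S a b) (σ : Zigzag S b c) (ρ : Zigzag S c d) :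
    comp (comp τ σ) ρ = comp τ (comp σ ρ) := by
  induction τ with
  | single g => simp [comp, precomp_comp]
  | cons g f hf r ih => simp [comp, ih]

lemma ladder_precomp {x x' w z : C} {v : x ⟶ x'} {g : x ⟶ w} {g' : x' ⟶ w} (h : v ≫ g' = g)
    (τ : Zigzag S w z) :
    Ladder (fun _ _ a b => a = b) v (precomp g τ) (precomp g' τ) := by
  induction τ generalizing x x' with
  | single k => exact .single (by simp [← h])
  | cons k f hf r ih =>
    refine .cons (.id _) (.id _) (by simp [← h]) (by simp) ?_
    simpa [precomp_id] using ih (v := 𝟙 _) (g := 𝟙 _) (g' := 𝟙 _) (by simp)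

lemma ladder_comp_left {x x' w z : C} {v : x ⟶ x'} {τ : Zigzag S x w} {τ' : Zigzag S x' w}
    (h : Ladder (fun _ _ a b => a = b) v τ τ') (σ : Zigzag S w z) :
    Ladder (fun _ _ a b => a = b) v (comp τ σ) (comp τ' σ) := by
  induction h with
  | single h => exact ladder_precomp h σ
  | cons hu hv h₁ h₂ _ ih => exact .cons hu hv h₁ h₂ (ih σ)

lemma rel_comp_left {w x z : C} {τ τ' : Zigzag S w x} (h : Rel τ τ') (σ : Zigzag S x z) :
    Rel (comp τ σ) (comp τ' σ) := by
  rcases h with h | h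
  · left
    induction h with
    | remove g hid r => rw [precomp_comp]; exact .remove g hid _
    | tail g f hf _ ih => exact .tail g f hf (ih σ)
  · exact Or.inr (ladder_comp_left h σ)

lemma rel_comp_right {w x z : C} (τ : Zigzag S w x) {σ σ' : Zigzag S x z} (h : Rel σ σ') :
    Rel (comp τ σ) (comp τ σ') := by
  induction τ with
  | single g =>
    rcases h with h | h
    · left
      cases h with
      | remove k hid r => rw [comp, comp, precomp_precomp]; exact .remove _ hid _
      | tail k f hf h => exact .tail _ f hf h
    · right
      cases h with
      | single h => exact .single (by simpa using congrArg (fun k => g ≫ k) h)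
      | cons hu hv h₁ h₂ h =>
        exact .cons hu hv (by simpa using congrArg (fun k => g ≫ k) h₁) h₂ h
  | cons g f hf r ih =>
    rcases ih h with h | h
    · exact Or.inl (.tail g f hf h)
    · exact Or.inr (.cons (.id _) (.id _) (by simp) (by simp) h)

end Zigzag

/-- The localization of the p-category `C` at `S`; it has the same objects as `C`. -/
structure Loc (S : MorphismProperty C) where
  /-- the underlying object of `C` -/
  obj : C

variable {S : MorphismProperty C}

/-- Morphisms in the localization are equivalence classes of zigzags, for the equivalence relation
generated by the horizontal and vertical relations. Composition is induced by concatenation. -/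
instance : Category (Loc S) where
  Hom w z := Quot (Zigzag.Rel (S := S) (w := w.obj) (z := z.obj))
  id w := Quot.mk _ (.single (𝟙 w.obj))
  comp a b := Quot.map₂ Zigzag.comp (fun τ _ _ h => Zigzag.rel_comp_right τ h)
    (fun _ _ σ h => Zigzag.rel_comp_left h σ) a b
  id_comp := by
    rintro w z ⟨τ⟩
    exact congrArg (Quot.mk _) (Zigzag.precomp_id τ)
  comp_id := by
    rintro w z ⟨τ⟩
    exact congrArg (Quot.mk _) (Zigzag.comp_single_id τ)
  assoc := by
    rintro a b c d ⟨τ⟩ ⟨σ⟩ ⟨ρ⟩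
    exact congrArg (Quot.mk _) (Zigzag.comp_assoc τ σ ρ)

/-- The class of a zigzag in the localization. -/
def Zigzag.cls {w z : Loc S} (τ : Zigzag S w.obj z.obj) : w ⟶ z := Quot.mk _ τ

/-- The order on the morphisms of the localization: `γ ≤ γ'` if there are representatives of `γ'`
and `γ` that are the top and bottom row, respectively, of an order diagram. -/
instance (w z : Loc S) : LE (w ⟶ z) where
  le γ γ' := ∃ τ τ' : Zigzag S w.obj z.obj,
    Zigzag.cls τ = γ ∧ Zigzag.cls τ' = γ' ∧ Zigzag.OrderDiagram τ' τ

end PLoc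

/-! ### Discrete Morse functions on regular CW complexes and their flow categories -/

namespace DiscreteMorse

open Topology

/-- A CW complex is regular if every attaching map (the restriction of the characteristic map to
the boundary sphere) is a homeomorphism onto its image. -/
def IsRegular {X : Type u} [TopologicalSpace X] (K : Set X) [CWComplex K] : Prop :=
  ∀ (n : ℕ) (i : RelCWComplex.cell K n),
    IsEmbedding ((Metric.sphere (0 : Fin n → ℝ) 1).domRestrict (RelCWComplex.map n i))

/-- The cells of a CW complex; they are the objects of its entrance path category. -/
structure Cell {X : Type u} [TopologicalSpace X] (K : Set X) [CWComplex K] where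
  /-- the dimension of the cell -/
  dim : ℕ
  /-- the index of the cell among the cells of that dimension -/
  idx : RelCWComplex.cell K dim

variable {X : Type u} [TopologicalSpace X] {K : Set X} [CWComplex K]

/-- The closed cell, as a subset of the complex. -/
def Cell.closed (x : Cell K) : Set X := RelCWComplex.closedCell x.dim x.idx

/-- A morphism `x ⟶ y` in the entrance path category: a strictly descending sequence of cells
`x = x₀ > x₁ > ⋯ > x_k = y`. -/
@[ext]
structure EntPath (x y : Cell K) where
  /-- the sequence of cells -/
  cells : List (Cell K)
  head_eq : cells.head? = some x
  last_eq : cells.getLast? = some y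
  descending : cells.IsChain (fun a b => b.closed ⊂ a.closed)

/-- The one-term sequence. -/
def EntPath.id (x : Cell K) : EntPath x x := ⟨[x], rfl, rfl, .singleton x⟩

lemma EntPath.cells_eq {x y : Cell K} (p : EntPath x y) : p.cells = x :: p.cells.tail := by
  obtain ⟨l, h, h', h''⟩ := p
  cases l with
  | nil => simp at h
  | cons a l => simpa using h

/-- Concatenation of sequences, the common cell being listed once. -/
def EntPath.comp {x y z : Cell K} (p : EntPath x y) (q : EntPath y z) : EntPath x z where
  cells := p.cells ++ q.cells.tail
  head_eq := by rw [p.cells_eq]; rfl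
  last_eq := by
    have h := q.last_eq
    rw [q.cells_eq] at h
    rw [List.getLast?_append, p.last_eq]
    cases ht : q.cells.tail with
    | nil => simpa [ht] using h
    | cons a t =>
      rw [ht, List.getLast?_cons_cons] at h
      rw [h]; rfl
  descending := by
    rw [List.isChain_append]
    have h := q.descending
    rw [q.cells_eq] at h
    refine ⟨p.descending, h.tail, ?_⟩
    intro a ha b hb
    rw [p.last_eq] at ha
    obtain rfl : y = a := by simpa using ha
    cases ht : q.cells.tail with
    | nil => simp [ht] at hb
    | cons c t =>
      rw [ht] at hb h
      obtain rfl : c = b := by simpa using hb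
      exact (List.isChain_cons_cons.mp h).1

/-- The entrance path category; `p ≤ q` means that `p` is a subsequence of `q`. -/
instance : PCategory (Cell K) where
  Hom x y := EntPath x y
  id x := EntPath.id x
  comp p q := p.comp q
  id_comp p := EntPath.ext p.cells_eq.symm
  comp_id p := EntPath.ext (List.append_nil _)
  assoc p q r := EntPath.ext (by
    simp only [EntPath.comp]
    rw [q.cells_eq]
    simp)
  homOrder x y :=
    { le := fun p q => p.cells.Sublist q.cells
      le_refl := fun p => List.Sublist.refl _
      le_trans := fun _ _ _ h h' => h.trans h'
      le_antisymm := fun _ _ h h' => EntPath.ext (h.antisymm h') }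
  comp_mono := fun {x y z p p' q q'} h h' => by
    refine List.Sublist.append h ?_
    change q.cells.Sublist q'.cells at h'
    rw [q.cells_eq, q'.cells_eq] at h'
    exact List.cons_sublist_cons.mp h'

/-- A discrete Morse function on a regular CW complex. -/
structure IsDiscreteMorse (f : Cell K → ℝ) : Prop where
  coface (x : Cell K) :
    {y : Cell K | y.dim = x.dim + 1 ∧ x.closed ⊆ y.closed ∧ f x ≥ f y}.Subsingleton
  face (x : Cell K) :
    {y : Cell K | x.dim = y.dim + 1 ∧ y.closed ⊆ x.closed ∧ f y ≥ f x}.Subsingleton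

/-- `{x, y}` is a regular pair, where `x` is the lower-dimensional cell. -/
def IsRegularPair (f : Cell K → ℝ) (x y : Cell K) : Prop :=
  y.dim = x.dim + 1 ∧ x.closed ⊆ y.closed ∧ f x ≥ f y

/-- The induced Morse system: the two-term sequences `(y > x)` for `{x, y}` a regular pair. -/
def morseSystem (f : Cell K → ℝ) : MorphismProperty (Cell K) :=
  fun y x (p : EntPath y x) => IsRegularPair f x y ∧ p.cells = [y, x]

/-- A cell is critical if it belongs to no regular pair. -/
def IsCritical (f : Cell K → ℝ) (x : Cell K) : Prop :=
  (¬ ∃ y : Cell K, y.dim = x.dim + 1 ∧ x.closed ⊆ y.closed ∧ f x ≥ f y) ∧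
  (¬ ∃ y : Cell K, x.dim = y.dim + 1 ∧ y.closed ⊆ x.closed ∧ f y ≥ f x)

/-- The discrete flow category: the full subcategory, on the critical cells, of the localization
of the entrance path category at the Morse system. -/
abbrev Flo (f : Cell K → ℝ) : Type u :=
  ObjectProperty.FullSubcategory (fun c : PLoc.Loc (morseSystem f) => IsCritical f c.obj)

/-- The order on the morphisms of the discrete flow category. -/
instance (f : Cell K → ℝ) (w z : Flo f) : LE (w ⟶ z) where
  le γ γ' := γ.hom ≤ γ'.hom

/-- `τ` represents the morphism `γ` of the discrete flow category. -/
def Represents {f : Cell K → ℝ} {w z : Flo f}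
    (τ : PLoc.Zigzag (morseSystem f) w.obj.obj z.obj.obj) (γ : w ⟶ z) : Prop :=
  PLoc.Zigzag.cls τ = γ.hom

end DiscreteMorse

namespace PLoc.Zigzag

variable {C : Type u} [PCategory.{v} C] {S : MorphismProperty C}

/-- A forward choice for `precomp h r` whose first map is `h ≫ g'`. -/
lemma forward_precomp {v w z : C} {h h' : v ⟶ w} (hh : h ≤ h') (r : Zigzag S w z)
    (g' : r.ForwardMaps) (hg : r.ForwardLE g') :
    ∃ k : (precomp h r).ForwardMaps, (precomp h r).ForwardLE k ∧
      (precomp h r).replaceForward k = precomp h' (r.replaceForward g') := by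
  cases r with
  | single g => exact ⟨h' ≫ g', PCategory.comp_mono hh hg, rfl⟩
  | cons g f hf r => exact ⟨(h' ≫ g'.1, g'.2), ⟨PCategory.comp_mono hh hg.1, hg.2⟩, rfl⟩

section Lifting

variable (hsplit : ∀ {x y z : C} (g : x ⟶ y) (h : y ⟶ z) (p : x ⟶ z), g ≫ h ≤ p →
    ∃ g' h', p = g' ≫ h' ∧ g ≤ g' ∧ h ≤ h')
  (hmax : ∀ {x y : C} (u u' : x ⟶ y), Plus S u → u ≤ u' → u' = u)

include hsplit in
lemma exists_forward_of_precomp {v w z : C} (h : v ⟶ w) (r : Zigzag S w z)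
    (k : (precomp h r).ForwardMaps) (hk : (precomp h r).ForwardLE k) :
    ∃ (h' : v ⟶ w) (g' : r.ForwardMaps), h ≤ h' ∧ r.ForwardLE g' ∧
      (precomp h r).replaceForward k = precomp h' (r.replaceForward g') := by
  cases r with
  | single g =>
    obtain ⟨h', g', e, h1, h2⟩ := hsplit h g k hk
    exact ⟨h', g', h1, h2, congrArg single e⟩
  | cons g f hf r =>
    obtain ⟨h', g', e, h1, h2⟩ := hsplit h g k.1 hk.1
    exact ⟨h', (g', k.2), h1, ⟨h2, hk.2⟩, by
      change cons k.1 f hf _ = cons (h' ≫ g') f hf _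
      rw [← e]⟩

lemma Horizontal.exists_forward {w z : C} {τ σ : Zigzag S w z} (h : Horizontal τ σ)
    (g' : τ.ForwardMaps) (hg : τ.ForwardLE g') :
    ∃ k : σ.ForwardMaps, σ.ForwardLE k ∧ Horizontal (τ.replaceForward g') (σ.replaceForward k) := by
  induction h with
  | remove g hid r =>
    obtain ⟨k, hk, e⟩ := forward_precomp hg.1 r g'.2 hg.2
    refine ⟨k, hk, ?_⟩
    rw [e]
    exact .remove _ hid _
  | tail g f hf _ ih =>
    obtain ⟨k, hk, e⟩ := ih g'.2 hg.2
    exact ⟨(g'.1, k), ⟨hg.1, hk⟩, .tail _ f hf e⟩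

include hsplit in
lemma Horizontal.exists_forward_symm {w z : C} {τ σ : Zigzag S w z} (h : Horizontal τ σ)
    (k : σ.ForwardMaps) (hk : σ.ForwardLE k) :
    ∃ g' : τ.ForwardMaps, τ.ForwardLE g' ∧
      Horizontal (τ.replaceForward g') (σ.replaceForward k) := by
  induction h with
  | remove g hid r =>
    obtain ⟨h', g', h1, h2, e⟩ := exists_forward_of_precomp hsplit g r k hk
    refine ⟨(h', g'), ⟨h1, h2⟩, ?_⟩
    rw [e]
    exact .remove _ hid _
  | tail g f hf _ ih =>
    obtain ⟨g', hg, e⟩ := ih k.2 hk.2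
    exact ⟨(k.1, g'), ⟨hk.1, hg⟩, .tail _ f hf e⟩

include hsplit hmax in
lemma Ladder.exists_forward {x x' z : C} {v : x ⟶ x'} {τ : Zigzag S x z} {σ : Zigzag S x' z}
    (h : Ladder (fun _ _ a b => a ≤ b) v τ σ) (hv : Plus S v) :
    ∃ k : σ.ForwardMaps, σ.ForwardLE k ∧
      Ladder (fun _ _ a b => a = b) v τ (σ.replaceForward k) := by
  induction h with
  | single h =>
    obtain ⟨v', k, e, h1, h2⟩ := hsplit _ _ _ h
    obtain rfl := hmax _ _ hv h1
    exact ⟨k, h2, .single e.symm⟩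
  | @cons x y x₁ x' y' x₁' z v u v₁ g f hf r g' f' hf' r' hu hv₁ h₁ h₂ _ ih =>
    obtain ⟨v', k, e, h1, h2⟩ := hsplit _ _ _ h₁
    obtain rfl := hmax _ _ hv h1
    obtain ⟨v', f'', e', h1', h2'⟩ := hsplit _ _ _ h₂
    obtain rfl := hmax _ _ hv₁ h1'
    obtain rfl := hmax _ _ hf' h2'
    obtain ⟨l, hl, H⟩ := ih hv₁
    exact ⟨(k, l), ⟨h2, hl⟩, .cons hu hv₁ e.symm e'.symm H⟩

lemma Ladder.mono_forward {x x' z : C} {v : x ⟶ x'} {τ : Zigzag S x z} {σ : Zigzag S x' z}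
    (h : Ladder (fun _ _ a b => a = b) v τ σ) (g' : τ.ForwardMaps) (hg : τ.ForwardLE g') :
    Ladder (fun _ _ a b => a ≤ b) v (τ.replaceForward g') σ := by
  induction h with
  | single h => exact .single (h.trans_le hg)
  | cons hu hv₁ h₁ h₂ _ ih =>
    exact .cons hu hv₁ (h₁.trans_le (PCategory.comp_mono hg.1 le_rfl)) h₂.le (ih _ hg.2)

include hsplit hmax in
lemma Ladder.exists_forward_symm {x x' z : C} {v : x ⟶ x'} {τ : Zigzag S x z} {σ : Zigzag S x' z}
    (h : Ladder (fun _ _ a b => a = b) v τ σ) (k : σ.ForwardMaps) (hk : σ.ForwardLE k) :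
    ∃ g' : τ.ForwardMaps, τ.ForwardLE g' ∧
      Ladder (fun _ _ a b => a = b) v (τ.replaceForward g') (σ.replaceForward k) := by
  induction h with
  | @single _ _ _ v _ _ h =>
    exact ⟨v ≫ k, h.symm.trans_le (PCategory.comp_mono le_rfl hk), .single rfl⟩
  | @cons x y x₁ x' y' x₁' z v u v₁ g f hf r g' f' hf' r' hu hv₁ h₁ h₂ _ ih =>
    obtain ⟨l, u', e, h1, h2⟩ := hsplit g u (v ≫ k.1)
      (h₁.symm.trans_le (PCategory.comp_mono le_rfl hk.1))
    obtain rfl := hmax _ _ hu h2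
    obtain ⟨m, hm, H⟩ := ih k.2 hk.2
    exact ⟨(l, m), ⟨h1, hm⟩, .cons hu hv₁ e h₂ H⟩

lemma cls_eq_of_rel {w z : Loc S} {τ σ : Zigzag S w.obj z.obj} (h : Rel τ σ) :
    cls τ = (cls σ : w ⟶ z) :=
  Quot.sound h

/-- `τ` can be enlarged, forward map by forward map, to a representative of `γ'`. -/
def Enlarges {w z : Loc S} (τ : Zigzag S w.obj z.obj) (γ' : w ⟶ z) : Prop :=
  ∃ g' : τ.ForwardMaps, τ.ForwardLE g' ∧ cls (τ.replaceForward g') = γ'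

include hsplit hmax in
lemma enlarges_iff_of_rel {w z : Loc S} {τ σ : Zigzag S w.obj z.obj} (h : Rel τ σ) (γ' : w ⟶ z) :
    Enlarges τ γ' ↔ Enlarges σ γ' := by
  constructor
  · rintro ⟨g', hg, rfl⟩
    rcases h with h | h
    · obtain ⟨k, hk, H⟩ := h.exists_forward g' hg
      exact ⟨k, hk, (cls_eq_of_rel (Or.inl H)).symm⟩
    · obtain ⟨k, hk, H⟩ := (Ladder.mono_forward h g' hg).exists_forward hsplit hmax (.id _)
      exact ⟨k, hk, (cls_eq_of_rel (Or.inr H)).symm⟩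
  · rintro ⟨k, hk, rfl⟩
    rcases h with h | h
    · obtain ⟨g', hg, H⟩ := h.exists_forward_symm hsplit k hk
      exact ⟨g', hg, cls_eq_of_rel (Or.inl H)⟩
    · obtain ⟨g', hg, H⟩ := Ladder.exists_forward_symm hsplit hmax h k hk
      exact ⟨g', hg, cls_eq_of_rel (Or.inr H)⟩

include hsplit hmax in
theorem enlarges_of_le {w z : Loc S} {γ γ' : w ⟶ z} (h : γ ≤ γ') (τ : Zigzag S w.obj z.obj)
    (hτ : cls τ = γ) : Enlarges τ γ' := by
  obtain ⟨σ, σ', rfl, rfl, H⟩ := h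
  obtain ⟨k, hk, H'⟩ := Ladder.exists_forward hsplit hmax H (.id _)
  have hσ : Enlarges σ (cls σ') := ⟨k, hk, (cls_eq_of_rel (Or.inr H')).symm⟩
  have key := congrArg (Quot.lift (fun ρ => Enlarges ρ (cls σ'))
    fun _ _ hr => propext (enlarges_iff_of_rel hsplit hmax hr _)) hτ
  exact key.mpr hσ

end Lifting

section Invariant

variable {E : Type*} (φ : ∀ ⦃x y : C⦄, (x ⟶ y) → List E)

/-- The concatenation of the labels of the forward maps. -/
def labels {w z : C} : Zigzag S w z → List E
  | single g => φ g
  | cons g _ _ r => φ g ++ labels r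

variable {φ} (hcomp : ∀ {x y z : C} (g : x ⟶ y) (h : y ⟶ z), φ (g ≫ h) = φ g ++ φ h)
  (hplus : ∀ {x y : C} (u : x ⟶ y), Plus S u → φ u = [])

include hcomp in
lemma labels_precomp {v w z : C} (h : v ⟶ w) (r : Zigzag S w z) :
    labels φ (precomp h r) = φ h ++ labels φ r := by
  cases r <;> simp [precomp, labels, hcomp]

include hcomp hplus in
lemma labels_eq_of_ladder {x x' z : C} {v : x ⟶ x'} {τ : Zigzag S x z} {σ : Zigzag S x' z}
    (h : Ladder (fun _ _ a b => a = b) v τ σ) (hv : Plus S v) : labels φ τ = labels φ σ := by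
  induction h with
  | @single _ _ _ v g g' h =>
    have := congrArg (φ ·) h
    simpa [hcomp, hplus v hv, labels] using this.symm
  | @cons x y x₁ x' y' x₁' z v u v₁ g f hf r g' f' hf' r' hu hv₁ h₁ h₂ _ ih =>
    have := congrArg (φ ·) h₁
    simp only [hcomp, hplus v hv, hplus u hu, List.nil_append, List.append_nil] at this
    simp [labels, ih hv₁, this]

include hcomp hplus in
lemma labels_eq_of_rel {w z : C} {τ σ : Zigzag S w z} (h : Rel τ σ) :
    labels φ τ = labels φ σ := by
  rcases h with h | h
  · induction h with
    | remove g hid r => rw [labels_precomp hcomp, labels]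
    | tail g f hf _ ih => rw [labels, labels, ih]
  · exact labels_eq_of_ladder hcomp hplus h (.id _)

include hcomp hplus in
lemma labels_eq_of_cls_eq {w z : Loc S} {τ σ : Zigzag S w.obj z.obj} (h : cls τ = cls σ) :
    labels φ τ = labels φ σ :=
  congrArg (Quot.lift (labels φ) fun _ _ hr => labels_eq_of_rel hcomp hplus hr) h

/-- If a label sequence determines a path among all parallel paths with a comparable label
sequence, then the labels of a zigzag of given shape determine its forward maps. -/
lemma eq_of_labels_eq
    (hinj : ∀ {x y : C} (p q : x ⟶ y), φ p <+: φ q → p = q)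
    {w z : C} (τ : Zigzag S w z) (g' g'' : τ.ForwardMaps)
    (h : labels φ (τ.replaceForward g') = labels φ (τ.replaceForward g'')) : g' = g'' := by
  induction τ with
  | single g => exact hinj g' g'' ((show φ g' = φ g'' from h) ▸ List.prefix_rfl)
  | cons g f hf r ih =>
    change φ g'.1 ++ labels φ (r.replaceForward g'.2)
      = φ g''.1 ++ labels φ (r.replaceForward g''.2) at h
    have h1 : g'.1 = g''.1 := by
      rcases List.prefix_or_prefix_of_prefix (List.prefix_append _ _)
        (h ▸ List.prefix_append _ _) with h' | h'
      · exact (hinj _ _ h').symm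
      · exact hinj _ _ h'
    rw [h1] at h
    exact Prod.ext h1 (ih _ _ (List.append_cancel_left h))

end Invariant

end PLoc.Zigzag

namespace DiscreteMorse

open Topology

variable {X : Type u} [TopologicalSpace X] {K : Set X} [CWComplex K]

lemma Cell.eq_of_mem_openCell {x y : Cell K} {p : X} (hx : p ∈ RelCWComplex.openCell x.dim x.idx)
    (hy : p ∈ RelCWComplex.openCell y.dim y.idx) : x = y := by
  have := RelCWComplex.eq_of_not_disjoint_openCell (Set.not_disjoint_iff.2 ⟨p, hx, hy⟩)
  obtain ⟨n, i⟩ := x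
  obtain ⟨m, j⟩ := y
  simp only [Sigma.mk.injEq] at this
  obtain ⟨rfl, h⟩ := this
  rw [eq_of_heq h]

lemma Cell.exists_mem_openCell_of_mem_cellFrontier {y : Cell K} {p : X}
    (hp : p ∈ RelCWComplex.cellFrontier y.dim y.idx) :
    ∃ x : Cell K, x.dim < y.dim ∧ p ∈ RelCWComplex.openCell x.dim x.idx := by
  obtain ⟨I, hI⟩ := CWComplex.cellFrontier_subset_finite_openCell y.dim y.idx
  have := hI hp
  simp only [Set.mem_iUnion] at this
  obtain ⟨m, hm, j, -, hj⟩ := this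
  exact ⟨⟨m, j⟩, hm, hj⟩

lemma Cell.mem_closed_iff {y : Cell K} {p : X} : p ∈ y.closed ↔
    p ∈ RelCWComplex.cellFrontier y.dim y.idx ∨ p ∈ RelCWComplex.openCell y.dim y.idx := by
  rw [Cell.closed, ← RelCWComplex.cellFrontier_union_openCell_eq_closedCell]
  rfl

lemma Cell.eq_or_dim_lt_of_mem {x y : Cell K} {p : X}
    (hx : p ∈ RelCWComplex.openCell x.dim x.idx) (hy : p ∈ y.closed) :
    x = y ∨ x.dim < y.dim := by
  rcases Cell.mem_closed_iff.1 hy with h | h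
  · obtain ⟨x', hlt, hx'⟩ := Cell.exists_mem_openCell_of_mem_cellFrontier h
    exact .inr (Cell.eq_of_mem_openCell hx hx' ▸ hlt)
  · exact .inl (Cell.eq_of_mem_openCell hx h)

lemma Cell.eq_or_dim_lt_of_subset {x y : Cell K} (h : x.closed ⊆ y.closed) :
    x = y ∨ x.dim < y.dim :=
  Cell.eq_or_dim_lt_of_mem (RelCWComplex.map_zero_mem_openCell _ _)
    (h (RelCWComplex.map_zero_mem_closedCell _ _))

lemma Cell.dim_lt_of_ssubset {x y : Cell K} (h : x.closed ⊂ y.closed) : x.dim < y.dim :=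
  (Cell.eq_or_dim_lt_of_subset h.subset).resolve_left fun e => h.ne (e ▸ rfl)

lemma EntPath.subset {x y : Cell K} (p : EntPath x y) : y.closed ⊆ x.closed := by
  obtain ⟨l, h1, h2, h3⟩ := p
  induction l generalizing x with
  | nil => simp at h1
  | cons a t ih =>
    obtain rfl : a = x := by simpa using h1
    cases t with
    | nil =>
      obtain rfl : a = y := by simpa using h2
      rfl
    | cons b t =>
      rw [List.isChain_cons_cons] at h3
      exact (ih rfl (by simpa using h2) h3.2).trans h3.1.subset

lemma split_of_comp_le {x y z : Cell K} (g : x ⟶ y) (h : y ⟶ z) (p : x ⟶ z) (hp : g ≫ h ≤ p) :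
    ∃ (g' : x ⟶ y) (h' : y ⟶ z), p = g' ≫ h' ∧ g ≤ g' ∧ h ≤ h' := by
  change (EntPath.comp g h).cells.Sublist p.cells at hp
  obtain ⟨l, hl⟩ := List.getLast?_eq_some_iff.1 g.last_eq
  simp only [EntPath.comp, hl, List.append_assoc] at hp
  obtain ⟨P₁, P₂, hP, h₁, h₂⟩ := List.append_sublist_iff.1 hp
  obtain ⟨r₁, r₂, rfl, hy, h₃⟩ := List.cons_sublist_iff.1 (by simpa using h₂)
  obtain ⟨s₁, s₂, rfl⟩ := List.append_of_mem hy
  have hP' : p.cells = (P₁ ++ s₁ ++ [y]) ++ (s₂ ++ r₂) := by simp [hP]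
  have hP'' : p.cells = (P₁ ++ s₁) ++ (y :: (s₂ ++ r₂)) := by simp [hP]
  have hg : g.cells.Sublist (P₁ ++ s₁ ++ [y]) := by
    rw [hl, List.append_assoc]
    exact h₁.append (List.sublist_append_right _ _)
  let g' : EntPath x y := ⟨P₁ ++ s₁ ++ [y], by
      have h0 := p.head_eq
      rw [hP', List.head?_append] at h0
      revert h0
      cases P₁ ++ s₁ <;> simp, by simp, by
      have h0 := p.descending
      rw [hP'] at h0
      exact h0.left_of_append⟩
  let h' : EntPath y z := ⟨y :: (s₂ ++ r₂), rfl, by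
      have h0 := p.last_eq
      rw [hP'', List.getLast?_append] at h0
      simpa using h0, by
      have h0 := p.descending
      rw [hP''] at h0
      exact h0.right_of_append⟩
  refine ⟨g', h', EntPath.ext hP', hg, ?_⟩
  change h.cells.Sublist (y :: (s₂ ++ r₂))
  rw [h.cells_eq]
  exact List.cons_sublist_cons.2 (h₃.trans (List.sublist_append_right _ _))

lemma EntPath.eq_singleton {x : Cell K} (p : EntPath x x) : p.cells = [x] := by
  obtain ⟨l, h1, h2, h3⟩ := p
  match l with
  | [] => simp at h1
  | [a] => simpa using h1
  | a :: b :: t =>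
    exfalso
    obtain rfl : a = x := by simpa using h1
    rw [List.isChain_cons_cons] at h3
    exact h3.1.not_subset (EntPath.subset ⟨b :: t, rfl, by simpa using h2, h3.2⟩)

lemma EntPath.eq_pair {x y : Cell K} (h : x.dim = y.dim + 1) (p : EntPath x y) :
    p.cells = [x, y] := by
  obtain ⟨l, h1, h2, h3⟩ := p
  match l with
  | [] => simp at h1
  | [a] =>
    obtain rfl : a = x := by simpa using h1
    obtain rfl : a = y := by simpa using h2
    omega
  | a :: b :: t =>
    obtain rfl : a = x := by simpa using h1
    rw [List.isChain_cons_cons] at h3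
    let q : EntPath b y := ⟨b :: t, rfl, by simpa using h2, h3.2⟩
    rcases Cell.eq_or_dim_lt_of_subset q.subset with rfl | hlt
    · simpa [q] using q.eq_singleton
    · have := Cell.dim_lt_of_ssubset h3.1
      omega

variable {f : Cell K → ℝ}

lemma eq_of_plus {x y : Cell K} (u u' : x ⟶ y) (hu : PLoc.Plus (morseSystem f) u) : u' = u := by
  apply EntPath.ext
  cases hu with
  | of hf => rw [EntPath.eq_pair hf.1.1 u', hf.2]
  | id => rw [EntPath.eq_singleton u']; rfl

open Classical in
/-- The consecutive pairs of a sequence of cells that are not regular pairs. -/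
noncomputable def nonregularSteps (f : Cell K → ℝ) : List (Cell K) → List (Cell K × Cell K)
  | a :: b :: t =>
    (if IsRegularPair f b a then [] else [(a, b)]) ++ nonregularSteps f (b :: t)
  | _ => []

lemma nonregularSteps_append (l : List (Cell K)) (b : Cell K) (t : List (Cell K)) :
    nonregularSteps f (l ++ b :: t) =
      nonregularSteps f (l ++ [b]) ++ nonregularSteps f (b :: t) := by
  induction l with
  | nil => simp [nonregularSteps]
  | cons a l ih =>
    cases l with
    | nil => simp [nonregularSteps]
    | cons c l =>
      simp only [List.cons_append] at ih ⊢
      rw [nonregularSteps, ih, nonregularSteps, List.append_assoc]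

lemma nonregularSteps_comp {x y z : Cell K} (g : x ⟶ y) (h : y ⟶ z) :
    nonregularSteps f (EntPath.cells (g ≫ h)) =
      nonregularSteps f g.cells ++ nonregularSteps f h.cells := by
  change nonregularSteps f (g.cells ++ h.cells.tail) = _
  obtain ⟨l, hl⟩ := List.getLast?_eq_some_iff.1 g.last_eq
  conv_rhs => rw [h.cells_eq]
  rw [hl, List.append_assoc, ← nonregularSteps_append]
  rfl

lemma nonregularSteps_of_plus {x y : Cell K} (u : x ⟶ y) (hu : PLoc.Plus (morseSystem f) u) :
    nonregularSteps f u.cells = [] := by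
  cases hu with
  | of hf => simp [hf.2, nonregularSteps, hf.1]
  | id => rfl

lemma closed_subset_of_mem_nonregularSteps {a : Cell K} {l : List (Cell K)}
    (hl : (a :: l).IsChain (fun a b : Cell K => b.closed ⊂ a.closed))
    {e : Cell K × Cell K} (he : e ∈ nonregularSteps f (a :: l)) : e.1.closed ⊆ a.closed := by
  induction l generalizing a with
  | nil => simp [nonregularSteps] at he
  | cons b t ih =>
    rw [List.isChain_cons_cons] at hl
    rw [nonregularSteps, List.mem_append] at he
    rcases he with he | he
    · split_ifs at he
      · simp at he
      · obtain rfl : e = (a, b) := by simpa using he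
        rfl
    · exact (ih hl.2 he).trans hl.1.subset

lemma eq_of_nonregularSteps_prefix (hf : IsDiscreteMorse f)
    (hpair : ∀ x y z : Cell K, IsRegularPair f x y → ¬ IsRegularPair f y z)
    {x y : Cell K} (p q : x ⟶ y)
    (h : nonregularSteps f p.cells <+: nonregularSteps f q.cells) : p = q := by
  suffices H : ∀ (l m : List (Cell K)) (a : Cell K),
      (a :: l).IsChain (fun a b : Cell K => b.closed ⊂ a.closed) →
      (a :: m).IsChain (fun a b : Cell K => b.closed ⊂ a.closed) →
      (a :: l).getLast? = some y → (a :: m).getLast? = some y →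
      nonregularSteps f (a :: l) <+: nonregularSteps f (a :: m) → l = m by
    apply EntPath.ext
    have h1 := p.descending
    have h2 := q.descending
    have h3 := p.last_eq
    have h4 := q.last_eq
    rw [p.cells_eq] at h1 h3 h ⊢
    rw [q.cells_eq] at h2 h4 h ⊢
    rw [H _ _ _ h1 h2 h3 h4 h]
  intro l
  induction l with
  | nil =>
    intro m a hl hm hl' hm' _
    obtain rfl : a = y := by simpa using hl'
    simpa using (EntPath.eq_singleton ⟨a :: m, rfl, hm', hm⟩).symm
  | cons b t ih =>
    intro m a hl hm hl' hm' h
    cases m with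
    | nil =>
      obtain rfl : a = y := by simpa using hm'
      exact EntPath.eq_singleton ⟨a :: b :: t, rfl, hl', hl⟩ |> fun e => by simp at e
    | cons c s =>
      rw [List.isChain_cons_cons] at hl hm
      rw [List.getLast?_cons_cons] at hl' hm'
      rw [nonregularSteps, nonregularSteps] at h
      by_cases hb : IsRegularPair f b a <;> by_cases hc : IsRegularPair f c a
      · obtain rfl : b = c := hf.face a ⟨hb.1, hb.2.1, hb.2.2⟩ ⟨hc.1, hc.2.1, hc.2.2⟩
        simp only [hb, if_true, List.nil_append] at h
        rw [ih s b hl.2 hm.2 hl' hm' h]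
      · simp only [hb, hc, if_true, if_false, List.nil_append, List.singleton_append] at h
        have hnil : nonregularSteps f (b :: t) = [] := by
          cases ht : nonregularSteps f (b :: t) with
          | nil => rfl
          | cons e r =>
            rw [ht, List.cons_prefix_cons] at h
            have := closed_subset_of_mem_nonregularSteps hl.2 (e := e) (by rw [ht]; simp)
            rw [h.1] at this
            exact absurd this hl.1.not_subset
        have ht : t = [] := by
          cases t with
          | nil => rfl
          | cons d t =>
            by_cases hd : IsRegularPair f d b
            · exact absurd hb (hpair _ _ _ hd)
            · simp [nonregularSteps, hd] at hnil
        subst ht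
        obtain rfl : b = y := by simpa using hl'
        have := EntPath.eq_pair hb.1 ⟨a :: c :: s, rfl, by simpa using hm',
          List.isChain_cons_cons.2 hm⟩
        simpa using this.symm
      · simp only [hb, hc, if_true, if_false, List.nil_append, List.singleton_append] at h
        have := closed_subset_of_mem_nonregularSteps hm.2 (h.subset (List.mem_cons_self))
        exact absurd this hm.1.not_subset
      · simp only [hb, hc, if_false, List.singleton_append, List.cons_prefix_cons,
          Prod.mk.injEq, true_and] at h
        obtain ⟨rfl, h⟩ := h
        rw [ih s b hl.2 hm.2 hl' hm' h]

end DiscreteMorse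

section InvarianceOfDomain

open MeasureTheory Metric Set Filter Topology
open scoped ContDiff Manifold

/-- The determinant of `1 + t • A` is a polynomial function of `t` of bounded degree. -/
lemma exists_polynomial_eval_eq_det_one_add_smul {E : Type*} [NormedAddCommGroup E]
    [NormedSpace ℝ E] [FiniteDimensional ℝ E] (A : E →L[ℝ] E) :
    ∃ p : Polynomial ℝ, p.natDegree ≤ Module.finrank ℝ E ∧
      ∀ t : ℝ, p.eval t = (1 + t • A).det := by
  classical
  let b := Module.finBasis ℝ E
  let M : Matrix _ _ ℝ := LinearMap.toMatrix b b (A : E →ₗ[ℝ] E)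
  refine ⟨Matrix.det ((Polynomial.X : Polynomial ℝ) • M.map Polynomial.C +
    (1 : Matrix _ _ ℝ).map Polynomial.C), ?_, fun t => ?_⟩
  · simpa using Polynomial.natDegree_det_X_add_C_le M 1
  · have h₁ : LinearMap.toMatrix b b ((1 + t • A : E →L[ℝ] E) : E →ₗ[ℝ] E) = 1 + t • M := by
      rw [ContinuousLinearMap.toLinearMap_add, ContinuousLinearMap.toLinearMap_smul, map_add,
        map_smul]
      exact congrArg (· + t • M) (LinearMap.toMatrix_one b)
    rw [ContinuousLinearMap.det, ← LinearMap.det_toMatrix b, h₁, ← Polynomial.coe_evalRingHom,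
      RingHom.map_det]
    congr 1
    ext i j
    rcases eq_or_ne i j with rfl | hij
    · simp only [Matrix.add_apply, Matrix.smul_apply, Matrix.one_apply_eq, RingHom.mapMatrix_apply,
        Matrix.map_apply, Polynomial.coe_evalRingHom, smul_eq_mul, Polynomial.eval_add,
        Polynomial.eval_mul, Polynomial.eval_X, Polynomial.eval_C]
      ring
    · simp only [Matrix.add_apply, Matrix.smul_apply, Matrix.one_apply_ne hij,
        RingHom.mapMatrix_apply, Matrix.map_apply, Polynomial.coe_evalRingHom, smul_eq_mul,
        Polynomial.eval_add, Polynomial.eval_mul, Polynomial.eval_X, Polynomial.eval_C]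
      ring

/-- There is no continuously differentiable retraction of a ball onto its boundary sphere. -/
theorem not_exists_contDiff_retraction {E : Type*} [NormedAddCommGroup E] [InnerProductSpace ℝ E]
    [FiniteDimensional ℝ E] (f : E → E) (hf : ContDiff ℝ 1 f)
    (h₁ : ∀ x, ‖x‖ ≤ 1 → ‖f x‖ = 1) (h₂ : ∀ x, ‖x‖ = 1 → f x = x) : False := by
  borelize E
  let h' : E → E →L[ℝ] E := fun x => fderiv ℝ f x - 1
  have hh'c : Continuous h' := (hf.continuous_fderiv one_ne_zero).sub continuous_const
  have hdiff : Differentiable ℝ f := hf.differentiable one_ne_zero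
  obtain ⟨M, hM⟩ := (isCompact_closedBall (0 : E) 1).exists_bound_of_continuousOn hh'c.continuousOn
  have hM0 : 0 ≤ M := (norm_nonneg _).trans (hM 0 (by simp))
  let F : ℝ → E → E := fun t x => x + t • (f x - x)
  have hF : ∀ t x, HasStrictFDerivAt (F t) (1 + t • h' x) x := fun t x =>
    (hasStrictFDerivAt_id x).add
      (((hf.contDiffAt.hasStrictFDerivAt one_ne_zero).sub (hasStrictFDerivAt_id x)).const_smul t)
  -- For small `t` the map `F t` is a diffeomorphism of the ball.
  have hsmall : ∀ t : ℝ, 0 < t → t < 1 → t * M < 1 →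
      ∫ x in ball (0 : E) 1, (1 + t • h' x).det = volume.real (ball (0 : E) 1) := by
    intro t ht0 ht1 htM
    have hnorm : ∀ x, ‖x‖ ≤ 1 → ∀ s ∈ Icc 0 t, ∀ v, v + s • h' x v = 0 → v = 0 := by
      intro x hx s hs v hv
      by_contra hv0
      have h1 : ‖v‖ = s * ‖h' x v‖ := by
        have := congrArg norm (eq_neg_of_add_eq_zero_left hv)
        rwa [norm_neg, norm_smul, Real.norm_of_nonneg hs.1] at this
      have h2 : ‖h' x v‖ ≤ M * ‖v‖ :=
        (h' x).le_of_opNorm_le (hM x (by simpa using hx)) v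
      have h3 : 0 < ‖v‖ := norm_pos_iff.2 hv0
      have h4 : s * ‖h' x v‖ ≤ t * (M * ‖v‖) :=
        mul_le_mul hs.2 h2 (norm_nonneg _) ht0.le
      nlinarith
    have hdet : ∀ x, ‖x‖ ≤ 1 → ∀ s ∈ Icc 0 t, (1 + s • h' x).det ≠ 0 := by
      intro x hx s hs h0
      obtain ⟨v, hv, hv0⟩ := Submodule.exists_mem_ne_zero_of_ne_bot
        (LinearMap.bot_lt_ker_of_det_eq_zero h0).ne'
      exact hv0 (hnorm x hx s hs v (by simpa using hv))
    have hpos : ∀ x, ‖x‖ ≤ 1 → 0 < (1 + t • h' x).det := by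
      intro x hx
      by_contra hneg
      have hc : ContinuousOn (fun s : ℝ => (1 + s • h' x).det) (Icc 0 t) :=
        (ContinuousLinearMap.continuous_det.comp (by fun_prop)).continuousOn
      obtain ⟨s, hs, hs0⟩ := intermediate_value_Icc' ht0.le hc (show (0 : ℝ) ∈ Icc _ _ from
        ⟨not_lt.1 hneg, by simp [ContinuousLinearMap.det]⟩)
      exact hdet x hx s hs hs0
    have hlip : LipschitzOnWith M.toNNReal (fun x => f x - x) (closedBall 0 1) := by
      refine (convex_closedBall (0 : E) 1).lipschitzOnWith_of_nnnorm_hasFDerivWithin_le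
        (f' := h') (fun x _ => ?_) fun x hx => ?_
      · exact ((hdiff x).hasFDerivAt.sub (hasFDerivAt_id x)).hasFDerivWithinAt
      · rw [← NNReal.coe_le_coe, Real.coe_toNNReal _ hM0]
        exact hM x hx
    have hinj : InjOn (F t) (closedBall 0 1) := by
      intro x hx y hy hxy
      by_contra hne
      have h1 : x - y = -(t • ((f x - x) - (f y - y))) := by
        have : x + t • (f x - x) = y + t • (f y - y) := hxy
        rw [smul_sub, neg_sub, sub_eq_sub_iff_add_eq_add, this, add_comm]
      have h2 : ‖x - y‖ = t * ‖(f x - x) - (f y - y)‖ := by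
        rw [h1, norm_neg, norm_smul, Real.norm_of_nonneg ht0.le]
      have h3 : ‖(f x - x) - (f y - y)‖ ≤ M * ‖x - y‖ := by
        have := hlip.dist_le_mul x hx y hy
        rwa [dist_eq_norm, dist_eq_norm, Real.coe_toNNReal _ hM0] at this
      have h4 : 0 < ‖x - y‖ := norm_pos_iff.2 (sub_ne_zero.2 hne)
      nlinarith
    have hmaps : ∀ x ∈ ball (0 : E) 1, F t x ∈ ball (0 : E) 1 := by
      intro x hx
      rw [mem_ball_zero_iff] at hx ⊢
      have : F t x = (1 - t) • x + t • f x := by simp only [F]; module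
      rw [this]
      calc ‖(1 - t) • x + t • f x‖ ≤ (1 - t) * ‖x‖ + t * ‖f x‖ := by
            refine (norm_add_le _ _).trans_eq ?_
            rw [norm_smul, norm_smul, Real.norm_of_nonneg ht0.le,
              Real.norm_of_nonneg (sub_nonneg.2 ht1.le)]
        _ < 1 := by rw [h₁ x hx.le]; nlinarith
    have himg : F t '' ball (0 : E) 1 = ball 0 1 := by
      refine Subset.antisymm (image_subset_iff.2 hmaps) ?_
      have hFc : Continuous (F t) := by
        have := hf.continuous
        fun_prop
      have hopen : IsOpen (F t '' ball (0 : E) 1) := by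
        rw [isOpen_iff_mem_nhds]
        rintro _ ⟨x, hx, rfl⟩
        rw [← (hF t x).map_nhds_eq_of_surj]
        · exact image_mem_map (isOpen_ball.mem_nhds hx)
        · have hinj' : Function.Injective ((1 + t • h' x : E →L[ℝ] E) : E →ₗ[ℝ] E) := by
            rw [← LinearMap.ker_eq_bot, LinearMap.ker_eq_bot']
            exact fun v hv => hnorm x (mem_ball_zero_iff.1 hx).le t ⟨ht0.le, le_rfl⟩ v
              (by simpa using hv)
          exact LinearMap.range_eq_top.2 (LinearMap.injective_iff_surjective.1 hinj')
      have hclosed : IsClosed (F t '' closedBall (0 : E) 1) :=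
        ((isCompact_closedBall 0 1).image hFc).isClosed
      have hsub : ball (0 : E) 1 ∩ F t '' closedBall (0 : E) 1 ⊆ F t '' ball (0 : E) 1 := by
        rintro _ ⟨hy, x, hx, rfl⟩
        rcases (mem_closedBall_zero_iff.1 hx).lt_or_eq with hlt | heq
        · exact ⟨x, mem_ball_zero_iff.2 hlt, rfl⟩
        · have : F t x = x := by simp [F, h₂ x heq]
          rw [this, mem_ball_zero_iff] at hy
          exact absurd heq hy.ne
      refine (convex_ball (0 : E) 1).isPreconnected.subset_of_closure_inter_subset hopen
        ⟨F t 0, hmaps 0 (by simp), 0, by simp, rfl⟩ ?_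
      intro y ⟨hy, hyb⟩
      exact hsub ⟨hyb, closure_minimal (image_mono ball_subset_closedBall) hclosed hy⟩
    have key := integral_image_eq_integral_abs_det_fderiv_smul volume measurableSet_ball
      (fun x _ => (hF t x).hasFDerivAt.hasFDerivWithinAt) (hinj.mono ball_subset_closedBall)
      (fun _ => (1 : ℝ))
    rw [himg] at key
    simp only [integral_const, smul_eq_mul, mul_one, measureReal_restrict_apply_univ] at key
    rw [key]
    refine setIntegral_congr_fun measurableSet_ball fun x hx => ?_
    exact (abs_of_pos (hpos x (mem_ball_zero_iff.1 hx).le)).symm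
  -- At time `1` the Jacobian vanishes.
  have hone : ∫ x in ball (0 : E) 1, (1 + (1 : ℝ) • h' x).det = 0 := by
    refine (setIntegral_congr_fun measurableSet_ball (g := fun _ => 0) fun x hx => ?_).trans
      (by simp)
    have hx1 : ‖x‖ < 1 := mem_ball_zero_iff.1 hx
    by_contra hdet
    have hsurj : Function.Surjective (fderiv ℝ f x) := by
      have e : 1 + (1 : ℝ) • h' x = fderiv ℝ f x := by simp [h']
      simp only [e] at hdet
      have hker := not_not.1 (LinearMap.det_eq_zero_iff_ker_ne_bot.not.1 hdet)
      exact LinearMap.injective_iff_surjective.1 (LinearMap.ker_eq_bot.1 hker)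
    obtain ⟨v, hv⟩ := hsurj (f x)
    have hd : HasFDerivAt (fun y => ‖f y‖ ^ 2) _ x := (hdiff x).hasFDerivAt.norm_sq
    have hc : (fun y => ‖f y‖ ^ 2) =ᶠ[𝓝 x] fun _ => (1 : ℝ) := by
      filter_upwards [isOpen_ball.mem_nhds hx] with y hy
      rw [h₁ y (mem_ball_zero_iff.1 hy).le, one_pow]
    have h0 := (hd.congr_of_eventuallyEq hc.symm).unique (hasFDerivAt_const (1 : ℝ) x)
    have h3 := congrArg (fun L => L v) h0
    simp [hv, h₁ x hx1.le] at h3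
  -- The integral of the Jacobian is a polynomial in `t`.
  let N := Module.finrank ℝ E + 1
  let ε : ℝ := 1 / (M + 2)
  have hε : 0 < ε := by positivity
  let node : ℕ → ℝ := fun i => ε / (i + 1)
  have hnode0 : ∀ i, 0 < node i := fun i => by positivity
  have hnodeε : ∀ i, node i ≤ ε := fun i =>
    div_le_self hε.le (by linarith [(Nat.cast_nonneg i : (0 : ℝ) ≤ i)])
  have hnode_inj : Function.Injective node := by
    intro i j hij
    have : (i : ℝ) + 1 = j + 1 := by
      have := hij
      simp only [node] at this
      field_simp at this
      linarith
    exact_mod_cast add_right_cancel this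
  let L : ℕ → ℝ := fun i => (Lagrange.basis (Finset.range N) node i).eval 1
  have hinterp : ∀ p : Polynomial ℝ, p.natDegree < N →
      p.eval 1 = ∑ i ∈ Finset.range N, p.eval (node i) * L i := by
    intro p hp
    have := Lagrange.eq_interpolate (s := Finset.range N) (v := node) hnode_inj.injOn (f := p)
      (by
        rw [Finset.card_range]
        exact (Polynomial.degree_le_natDegree).trans_lt (by exact_mod_cast hp))
    conv_lhs => rw [this]
    simp [Lagrange.interpolate_apply, Polynomial.eval_finsetSum, L]
  have hsum : ∑ i ∈ Finset.range N, L i = 1 := by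
    simpa using (hinterp 1 (by simp [N])).symm
  have hint : ∀ t : ℝ, IntegrableOn (fun x => (1 + t • h' x).det) (ball (0 : E) 1) := fun t =>
    ((ContinuousLinearMap.continuous_det.comp (by fun_prop)).continuousOn.integrableOn_compact
      (isCompact_closedBall (0 : E) 1)).mono_set ball_subset_closedBall
  have hfinal : ∫ x in ball (0 : E) 1, (1 + (1 : ℝ) • h' x).det =
      volume.real (ball (0 : E) 1) := by
    calc ∫ x in ball (0 : E) 1, (1 + (1 : ℝ) • h' x).det
        = ∫ x in ball (0 : E) 1, ∑ i ∈ Finset.range N, (1 + node i • h' x).det * L i := by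
          refine setIntegral_congr_fun measurableSet_ball fun x _ => ?_
          obtain ⟨p, hp, hpe⟩ := exists_polynomial_eval_eq_det_one_add_smul (h' x)
          simp only [← hpe]
          exact hinterp p (Nat.lt_succ_of_le hp)
      _ = ∑ i ∈ Finset.range N, (∫ x in ball (0 : E) 1, (1 + node i • h' x).det) * L i := by
          rw [integral_finsetSum _ fun i _ => (hint _).mul_const _]
          simp_rw [integral_mul_const]
      _ = ∑ i ∈ Finset.range N, volume.real (ball (0 : E) 1) * L i := by
          refine Finset.sum_congr rfl fun i _ => ?_
          have hM2 : ε * (M + 2) = 1 := by simp only [ε]; field_simp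
          rw [hsmall _ (hnode0 i)]
          · nlinarith [hnodeε i]
          · nlinarith [hnodeε i, mul_le_mul_of_nonneg_right (hnodeε i) hM0]
      _ = volume.real (ball (0 : E) 1) := by rw [← Finset.mul_sum, hsum, mul_one]
  have hvol : 0 < volume.real (ball (0 : E) 1) :=
    ENNReal.toReal_pos (measure_ball_pos _ _ one_pos).ne' measure_ball_lt_top.ne
  rw [hone] at hfinal
  exact hvol.ne hfinal

variable {E : Type*} [NormedAddCommGroup E] [InnerProductSpace ℝ E] [FiniteDimensional ℝ E]

lemma Continuous.exists_contDiff_dist_lt {F : E → E} (hF : Continuous F) {δ : ℝ} (hδ : 0 < δ) :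
    ∃ P : E → E, ContDiff ℝ 1 P ∧ ∀ x, dist (P x) (F x) < δ := by
  obtain ⟨g, hg⟩ := exists_contMDiffMap_forall_mem_convex_of_local_const (n := 1) 𝓘(ℝ, E)
    (t := fun x => ball (F x) δ) (fun x => convex_ball _ _) fun x => ⟨F x, by
      filter_upwards [hF.continuousAt.preimage_mem_nhds (ball_mem_nhds (F x) hδ)] with y hy
      rw [mem_ball, dist_comm]
      exact hy⟩
  exact ⟨g, g.contMDiff.contDiff, hg⟩

/-- A continuous self-map of a Euclidean space that is the identity far away has a zero. -/
theorem exists_eq_zero_of_eq_self {F : E → E} (hF : Continuous F)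
    (hid : ∀ x, 2 ≤ ‖x‖ → F x = x) : ∃ x, F x = 0 := by
  by_contra! hne
  obtain ⟨δ, hδ, hFδ⟩ : ∃ δ : ℝ, 0 < δ ∧ ∀ x ∈ closedBall (0 : E) 3, δ ≤ ‖F x‖ := by
    obtain ⟨x, -, hx⟩ := (isCompact_closedBall (0 : E) 3).exists_isMinOn ⟨0, by simp⟩
      hF.norm.continuousOn
    exact ⟨‖F x‖, norm_pos_iff.2 (hne x), fun y hy => hx hy⟩
  classical
  let t : E → Set E := fun x => if 3 ≤ ‖x‖ then {x} else ball (F x) δ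
  have ht : ∀ x, Convex ℝ (t x) := by
    intro x
    simp only [t]
    split_ifs
    exacts [convex_singleton x, convex_ball _ _]
  obtain ⟨g, hg⟩ := exists_contMDiffMap_forall_mem_convex_of_local (n := 1) 𝓘(ℝ, E) ht (by
    intro x
    rcases lt_or_ge 2 ‖x‖ with hx | hx
    · refine ⟨{y | 2 < ‖y‖}, (isOpen_lt continuous_const continuous_norm).mem_nhds hx, id,
        contMDiff_id.contMDiffOn, fun y hy => ?_⟩
      simp only [t]
      split_ifs
      · simp
      · simpa [hid y (le_of_lt hy)] using hδ
    · refine ⟨{y | ‖y‖ < 3} ∩ F ⁻¹' ball (F x) δ,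
        inter_mem ((isOpen_lt continuous_norm continuous_const).mem_nhds
          (hx.trans_lt (by norm_num)))
          (hF.continuousAt.preimage_mem_nhds (ball_mem_nhds _ hδ)), fun _ => F x,
        contMDiffOn_const, fun y hy => ?_⟩
      have hy3 : ¬ 3 ≤ ‖y‖ := not_le.2 hy.1
      simp only [t, if_neg hy3]
      rw [mem_ball, dist_comm]
      exact hy.2)
  have hg3 : ∀ x, 3 ≤ ‖x‖ → g x = x := fun x hx => by simpa [t, hx] using hg x
  have hg0 : ∀ x, g x ≠ 0 := by
    intro x
    rcases le_or_gt 3 ‖x‖ with hx | hx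
    · rw [hg3 x hx]
      exact norm_pos_iff.1 (by linarith)
    · intro h0
      have h1 := hg x
      simp only [t, if_neg (not_le.2 hx), h0, mem_ball, dist_zero_left] at h1
      exact h1.not_ge (hFδ x (by simpa using hx.le))
  have hgc : ContDiff ℝ 1 (fun x : E => g ((3 : ℝ) • x)) :=
    g.contMDiff.contDiff.comp (contDiff_const_smul (3 : ℝ))
  refine not_exists_contDiff_retraction (fun x : E => ‖g ((3 : ℝ) • x)‖⁻¹ • g ((3 : ℝ) • x))
    (((hgc.norm ℝ fun x => hg0 _).inv fun x => norm_ne_zero_iff.2 (hg0 _)).smul hgc)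
    (fun x _ => ?_) fun x hx => ?_
  · rw [norm_smul, norm_inv, norm_norm, inv_mul_cancel₀ (norm_ne_zero_iff.2 (hg0 _))]
  · have h3 : ‖(3 : ℝ) • x‖ = 3 := by simp [norm_smul, hx]
    simp only [hg3 _ h3.ge, h3, smul_smul]
    norm_num

/-- A continuous map on the unit ball that is close to the identity has a zero. -/
theorem exists_eq_zero_of_norm_sub_lt_one {φ : E → E} (hφ : ContinuousOn φ (closedBall 0 1))
    (h : ∀ x ∈ closedBall (0 : E) 1, ‖φ x - x‖ < 1) : ∃ x ∈ closedBall (0 : E) 1, φ x = 0 := by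
  let r : E → E := fun x => (max 1 ‖x‖)⁻¹ • x
  have hpos : ∀ x : E, 0 < max 1 ‖x‖ := fun x => one_pos.trans_le (le_max_left _ _)
  have hr : ∀ x, r x ∈ closedBall (0 : E) 1 := by
    intro x
    rw [mem_closedBall_zero_iff, norm_smul, norm_inv, Real.norm_of_nonneg (hpos x).le,
      inv_mul_le_one₀ (hpos x)]
    exact le_max_right _ _
  have hrc : Continuous r :=
    ((continuous_const.max continuous_norm).inv₀ fun x => (hpos x).ne').smul continuous_id
  let l : E → ℝ := fun x => max 0 (2 - max 1 ‖x‖)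
  have hl1 : ∀ x, l x ≤ 1 := fun x =>
    max_le zero_le_one (by linarith [le_max_left 1 ‖x‖])
  have hl0 : ∀ x, 0 ≤ l x := fun x => le_max_left _ _
  obtain ⟨x, hx⟩ := exists_eq_zero_of_eq_self (F := fun x => x + l x • (φ (r x) - r x))
    (continuous_id.add ((continuous_const.max
      (continuous_const.sub (continuous_const.max continuous_norm))).smul
        ((hφ.comp_continuous hrc hr).sub hrc))) (by
      intro x hx
      have : l x = 0 := max_eq_left (by linarith [le_max_right 1 ‖x‖])
      simp [this])
  have hx1 : ‖x‖ ≤ 1 := by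
    have h1 := congrArg norm (eq_neg_of_add_eq_zero_left hx)
    rw [norm_neg, norm_smul, Real.norm_of_nonneg (hl0 x)] at h1
    rw [h1]
    exact mul_le_one₀ (hl1 x) (norm_nonneg _) (h _ (hr x)).le
  have hrx : r x = x := by simp [r, max_eq_left hx1]
  have hlx : l x = 1 := by simp only [l, max_eq_left hx1]; norm_num
  refine ⟨x, mem_closedBall_zero_iff.2 hx1, ?_⟩
  simpa [hrx, hlx] using hx

/-- A continuous injective map on the unit ball sends the center to an interior point of the
image. -/
theorem mem_interior_image_closedBall {f : E → E} (hf : ContinuousOn f (closedBall 0 1))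
    (hinj : InjOn f (closedBall 0 1)) : f 0 ∈ interior (f '' closedBall 0 1) := by
  borelize E
  by_contra hint
  have hK : IsCompact (f '' closedBall 0 1) := (isCompact_closedBall _ _).image_of_continuousOn hf
  -- A continuous left inverse of `f`, defined everywhere.
  obtain ⟨G, hG⟩ : ∃ G : C(E, E), ∀ x ∈ closedBall (0 : E) 1, G (f x) = x := by
    have hemb : IsClosedEmbedding ((closedBall (0 : E) 1).domRestrict f) :=
      have : CompactSpace (closedBall (0 : E) 1) :=
        isCompact_iff_compactSpace.1 (isCompact_closedBall _ _)
      (continuousOn_iff_continuous_domRestrict.1 hf).isClosedEmbedding hinj.injective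
    have : TietzeExtension.{_, _} E := RCLike.instTietzeExtensionTVS (𝕜 := ℝ)
    obtain ⟨G, hG⟩ := ContinuousMap.exists_extension hemb
      (⟨Subtype.val, continuous_subtype_val⟩ : C(closedBall (0 : E) 1, E))
    exact ⟨G, fun x hx => DFunLike.congr_fun hG ⟨x, hx⟩⟩
  have hG0 : G (f 0) = 0 := hG 0 (by simp)
  obtain ⟨ε, hε, hGε⟩ : ∃ ε > 0, ∀ y, dist y (f 0) < 2 * ε → ‖G y‖ < 1 / 4 := by
    obtain ⟨ε, hε, h⟩ := Metric.continuousAt_iff.1 G.continuous.continuousAt (1 / 4) (by norm_num)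
    refine ⟨ε / 2, by positivity, fun y hy => ?_⟩
    have := h (show dist y (f 0) < ε by linarith)
    rwa [hG0, dist_zero_right] at this
  obtain ⟨c, hc, hcK⟩ : ∃ c, dist c (f 0) < ε ∧ c ∉ f '' closedBall 0 1 := by
    by_contra! hall
    exact hint (mem_interior_iff_mem_nhds.2 (mem_of_superset (ball_mem_nhds _ hε) hall))
  -- `G` is bounded below on the part of the image away from `c`.
  obtain ⟨δ, hδ, hδ4, hGδ⟩ : ∃ δ : ℝ, 0 < δ ∧ δ ≤ 1 / 4 ∧
      ∀ y ∈ f '' closedBall 0 1, ε ≤ dist y c → δ ≤ ‖G y‖ := by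
    have hS : IsCompact (f '' closedBall 0 1 ∩ {y | ε ≤ dist y c}) :=
      hK.inter_right (isClosed_le continuous_const (continuous_id.dist continuous_const))
    rcases (f '' closedBall 0 1 ∩ {y | ε ≤ dist y c}).eq_empty_or_nonempty with he | hne
    · exact ⟨1 / 4, by norm_num, le_rfl, fun y hy hyc =>
        (eq_empty_iff_forall_notMem.1 he y ⟨hy, hyc⟩).elim⟩
    · obtain ⟨y, ⟨⟨x, hx, rfl⟩, hyc⟩, hmin⟩ := hS.exists_isMinOn hne G.continuous.norm.continuousOn
      refine ⟨min (1 / 4) ‖G (f x)‖, lt_min (by norm_num) (norm_pos_iff.2 ?_), min_le_left _ _,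
        fun y hy hyc => (min_le_right _ _).trans (hmin ⟨hy, hyc⟩)⟩
      rw [hG x hx]
      rintro rfl
      rw [mem_ofPred_eq, dist_comm] at hyc
      exact absurd hc hyc.not_gt
  obtain ⟨P, hP, hPG, hPc⟩ : ∃ P : E → E, Continuous P ∧ (∀ y, ‖P y - G y‖ < δ) ∧
      ∀ y ∈ sphere c ε, P y ≠ 0 := by
    obtain ⟨Q, hQ, hQG⟩ := G.continuous.exists_contDiff_dist_lt (half_pos hδ)
    have hnull : volume (Q '' sphere c ε) = 0 :=
      addHaar_image_eq_zero_of_differentiableOn_of_addHaar_eq_zero volume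
        (hQ.differentiable one_ne_zero).differentiableOn
        (Measure.addHaar_sphere_of_ne_zero volume c hε.ne')
    obtain ⟨v, hv, hvQ⟩ : ∃ v ∈ ball (0 : E) (δ / 2), v ∉ Q '' sphere c ε := by
      by_contra! hall
      exact (measure_ball_pos volume (0 : E) (half_pos hδ)).ne'
        (measure_mono_null hall hnull)
    refine ⟨fun y => Q y - v, hQ.continuous.sub continuous_const, fun y => ?_, fun y hy h0 => ?_⟩
    · have h1 := hQG y
      rw [dist_eq_norm] at h1
      rw [mem_ball_zero_iff] at hv
      calc ‖Q y - v - G y‖ = ‖(Q y - G y) - v‖ := by congr 1; abel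
        _ ≤ ‖Q y - G y‖ + ‖v‖ := norm_sub_le _ _
        _ < δ := by linarith
    · exact hvQ ⟨y, hy, sub_eq_zero.1 h0⟩
  -- Push the image of `f` out of the `ε`-ball around `c`.
  let Φ : E → E := fun y => c + max (ε / dist y c) 1 • (y - c)
  have hΦfar : ∀ y, ε ≤ dist y c → Φ y = y := by
    intro y hy
    have : ε / dist y c ≤ 1 := div_le_one_of_le₀ hy dist_nonneg
    simp [Φ, max_eq_right this]
  have hΦnear : ∀ y, y ≠ c → dist y c < ε → dist (Φ y) c = ε := by
    intro y hyc hy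
    have hpos : 0 < dist y c := dist_pos.2 hyc
    have : 1 ≤ ε / dist y c := (one_le_div hpos).2 hy.le
    simp only [Φ, max_eq_left this, dist_self_add_left, norm_smul, ← dist_eq_norm]
    rw [Real.norm_of_nonneg (by positivity), div_mul_cancel₀ _ hpos.ne']
  have hΦc : ContinuousOn Φ {c}ᶜ := by
    have h1 : ContinuousOn (fun y => ε / dist y c) {c}ᶜ :=
      continuousOn_const.div (by fun_prop) fun y hy => dist_ne_zero.2 hy
    exact continuousOn_const.add ((h1.sup continuousOn_const).smul (by fun_prop))
  have hfc : ∀ x ∈ closedBall (0 : E) 1, f x ≠ c := fun x hx h => hcK ⟨x, hx, h⟩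
  obtain ⟨x, hx, hx0⟩ := exists_eq_zero_of_norm_sub_lt_one (φ := fun x => P (Φ (f x)))
    (hP.comp_continuousOn (hΦc.comp hf hfc)) (by
      intro x hx
      rw [← hG x hx, hG x hx]
      rcases le_or_gt ε (dist (f x) c) with h | h
      · rw [hΦfar _ h]
        have := hPG (f x)
        rw [hG x hx] at this
        linarith
      · have h1 := hΦnear _ (hfc x hx) h
        have h2 : ‖G (Φ (f x))‖ < 1 / 4 :=
          hGε _ (by linarith [dist_triangle (Φ (f x)) c (f 0)])
        have h3 : ‖x‖ < 1 / 4 := by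
          have := hGε (f x) (by linarith [dist_triangle (f x) c (f 0)])
          rwa [hG x hx] at this
        have h4 := hPG (Φ (f x))
        calc ‖P (Φ (f x)) - x‖
            = ‖(P (Φ (f x)) - G (Φ (f x))) + G (Φ (f x)) - x‖ := by rw [sub_add_cancel]
          _ ≤ ‖P (Φ (f x)) - G (Φ (f x))‖ + ‖G (Φ (f x))‖ + ‖x‖ :=
            (norm_sub_le _ _).trans (add_le_add_left (norm_add_le _ _) _)
          _ < 1 := by linarith)
  rcases le_or_gt ε (dist (f x) c) with h | h
  · simp only [hΦfar _ h] at hx0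
    have h1 := hPG (f x)
    rw [hx0, zero_sub, norm_neg] at h1
    exact h1.not_ge (hGδ _ ⟨x, hx, rfl⟩ h)
  · exact hPc _ (hΦnear _ (hfc x hx) h) hx0

/-- **Invariance of domain** for Euclidean spaces. -/
theorem isOpen_image_of_continuousOn_injOn {f : E → E} {U : Set E} (hU : IsOpen U)
    (hf : ContinuousOn f U) (hinj : InjOn f U) : IsOpen (f '' U) := by
  rw [isOpen_iff_mem_nhds]
  rintro _ ⟨x, hx, rfl⟩
  obtain ⟨r, hr, hrU⟩ := nhds_basis_closedBall.mem_iff.1 (hU.mem_nhds hx)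
  have hmaps : MapsTo (fun y : E => x + r • y) (closedBall 0 1) U := by
    intro y hy
    refine hrU ?_
    rw [mem_closedBall_zero_iff] at hy
    rw [mem_closedBall, dist_self_add_left, norm_smul, Real.norm_of_nonneg hr.le]
    nlinarith
  have h := mem_interior_image_closedBall (f := fun y => f (x + r • y))
    (hf.comp (by fun_prop) hmaps) (hinj.comp (fun y _ y' _ h => by
      simpa [hr.ne'] using h) hmaps)
  simp only [smul_zero, add_zero] at h
  refine mem_of_superset (mem_interior_iff_mem_nhds.1 h) ?_
  rintro _ ⟨y, hy, rfl⟩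
  exact mem_image_of_mem f (hmaps hy)

theorem isOpen_image_pi_of_continuousOn_injOn {n : ℕ} {f : (Fin n → ℝ) → (Fin n → ℝ)}
    {U : Set (Fin n → ℝ)} (hU : IsOpen U) (hf : ContinuousOn f U) (hinj : InjOn f U) :
    IsOpen (f '' U) := by
  let e := (EuclideanSpace.equiv (Fin n) ℝ).toHomeomorph
  have h := isOpen_image_of_continuousOn_injOn (f := fun x => e.symm (f (e x)))
    (hU.preimage e.continuous)
    (e.symm.continuous.comp_continuousOn (hf.comp e.continuous.continuousOn fun _ h => h))
    (e.symm.injective.comp_injOn (hinj.comp e.injective.injOn fun _ h => h))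
  convert h.preimage e.symm.continuous using 1
  ext y
  constructor
  · rintro ⟨x, hx, rfl⟩
    exact ⟨e.symm x, by simpa using hx, by simp⟩
  · rintro ⟨x, hx, hxy⟩
    exact ⟨e x, hx, e.symm.injective hxy⟩

/-- Invariance of domain for maps from a sphere to a space of the same dimension. -/
theorem isOpen_image_sphere_of_continuousOn_injOn {d : ℕ} {h : (Fin (d + 1) → ℝ) → (Fin d → ℝ)}
    {W : Set (Fin (d + 1) → ℝ)} (hW : IsOpen W)
    (hh : ContinuousOn h (sphere 0 1 ∩ W)) (hinj : InjOn h (sphere 0 1 ∩ W)) :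
    IsOpen (h '' (sphere 0 1 ∩ W)) := by
  let ν : (Fin (d + 1) → ℝ) → (Fin (d + 1) → ℝ) := fun x => ‖x‖⁻¹ • x
  let U : Set (Fin (d + 1) → ℝ) := {0}ᶜ ∩ ν ⁻¹' W
  have hν : ContinuousOn ν {0}ᶜ :=
    (continuousOn_id.norm.inv₀ fun x hx => norm_ne_zero_iff.2 hx).smul continuousOn_id
  have hU : IsOpen U := hν.isOpen_inter_preimage isOpen_compl_singleton hW
  have hmaps : MapsTo ν U (sphere 0 1 ∩ W) := by
    intro x hx
    refine ⟨?_, hx.2⟩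
    rw [mem_sphere_zero_iff_norm, norm_smul, norm_inv, norm_norm,
      inv_mul_cancel₀ (norm_ne_zero_iff.2 hx.1)]
  have hopen := isOpen_image_pi_of_continuousOn_injOn (U := U)
    (f := fun x => Fin.cons ‖x‖ (h (ν x))) hU
    (continuousOn_pi.2 fun i => by
      refine Fin.cases ?_ (fun j => ?_) i
      · simpa using continuous_norm.continuousOn
      · simp only [Fin.cons_succ]
        exact (continuous_apply j).comp_continuousOn
          (hh.comp (hν.mono inter_subset_left) hmaps))
    (fun x hx y hy hxy => by
      obtain ⟨h1, h2⟩ := Fin.cons_inj.1 hxy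
      have h3 := hinj (hmaps hx) (hmaps hy) h2
      simp only [ν, h1] at h3
      exact smul_right_injective _ (inv_ne_zero (norm_ne_zero_iff.2 hy.1)) h3)
  have hc : Continuous fun y : Fin d → ℝ => (Fin.cons 1 y : Fin (d + 1) → ℝ) :=
    continuous_pi fun i => by
      refine Fin.cases ?_ (fun j => ?_) i
      · simpa using continuous_const
      · simpa using continuous_apply j
  convert hopen.preimage hc using 1
  ext y
  constructor
  · rintro ⟨x, hx, rfl⟩
    have hx1 : ‖x‖ = 1 := mem_sphere_zero_iff_norm.1 hx.1
    have hνx : ν x = x := by simp [ν, hx1]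
    exact ⟨x, ⟨norm_ne_zero_iff.1 (by rw [hx1]; exact one_ne_zero),
      by rw [mem_preimage, hνx]; exact hx.2⟩, by simp only [hx1, hνx]⟩
  · rintro ⟨x, hx, hxy⟩
    exact ⟨ν x, hmaps hx, (Fin.cons_inj.1 hxy).2⟩

end InvarianceOfDomain

namespace DiscreteMorse

open Topology Metric Set

variable {X : Type u} [TopologicalSpace X] {K : Set X} [CWComplex K]

lemma notMem_openCell_of_mem_cellFrontier {n : ℕ} {i : RelCWComplex.cell K n} {p : X}
    (hp : p ∈ RelCWComplex.cellFrontier n i) : p ∉ RelCWComplex.openCell n i := by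
  intro h
  obtain ⟨x, hlt, hx⟩ := Cell.exists_mem_openCell_of_mem_cellFrontier (y := ⟨n, i⟩) hp
  have := Cell.eq_of_mem_openCell (y := ⟨n, i⟩) hx h
  subst this
  exact lt_irrefl _ hlt

lemma IsRegular.injOn_map (hK : IsRegular K) (n : ℕ) (i : RelCWComplex.cell K n) :
    InjOn (RelCWComplex.map n i) (closedBall 0 1) := by
  intro x hx y hy hxy
  rw [← ball_union_sphere] at hx hy
  rcases hx with hx | hx <;> rcases hy with hy | hy
  · exact (RelCWComplex.map n i).injOn (by rwa [RelCWComplex.source_eq])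
      (by rwa [RelCWComplex.source_eq]) hxy
  · exact absurd ⟨x, hx, hxy⟩ (notMem_openCell_of_mem_cellFrontier ⟨y, hy, rfl⟩)
  · exact absurd ⟨y, hy, hxy.symm⟩ (notMem_openCell_of_mem_cellFrontier ⟨x, hx, rfl⟩)
  · exact congrArg Subtype.val ((hK n i).injective (a₁ := ⟨x, hx⟩) (a₂ := ⟨y, hy⟩) hxy)

/-- The inverse of the characteristic map of a closed cell. -/
lemma IsRegular.exists_chart [T2Space X] (hK : IsRegular K) (n : ℕ) (i : RelCWComplex.cell K n) :
    ∃ ψ : X → (Fin n → ℝ), ContinuousOn ψ (RelCWComplex.closedCell n i) ∧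
      ∀ x ∈ closedBall (0 : Fin n → ℝ) 1, ψ (RelCWComplex.map n i x) = x := by
  have hinj := hK.injOn_map n i
  refine ⟨Function.invFunOn (RelCWComplex.map n i) (closedBall 0 1), ?_,
    fun x hx => hinj.leftInvOn_invFunOn hx⟩
  rw [continuousOn_iff_isClosed]
  intro t ht
  refine ⟨RelCWComplex.map n i '' (closedBall 0 1 ∩ t),
    (((isCompact_closedBall 0 1).inter_right ht).image_of_continuousOn
      ((RelCWComplex.continuousOn n i).mono inter_subset_left)).isClosed, ?_⟩
  ext p
  constructor
  · rintro ⟨hp, x, hx, rfl⟩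
    rw [mem_preimage, hinj.leftInvOn_invFunOn hx] at hp
    exact ⟨⟨x, ⟨hx, hp⟩, rfl⟩, x, hx, rfl⟩
  · rintro ⟨⟨x, ⟨hx, hxt⟩, rfl⟩, hp⟩
    refine ⟨?_, hp⟩
    rwa [mem_preimage, hinj.leftInvOn_invFunOn hx]

/-- Invariance of domain for the boundary sphere of a cell. -/
lemma IsRegular.isOpen_image_cellFrontier (hK : IsRegular K) {d : ℕ}
    (i : RelCWComplex.cell K (d + 1)) {U : Set X} (hU : IsOpen U) {h : X → (Fin d → ℝ)}
    (hh : ContinuousOn h (RelCWComplex.cellFrontier (d + 1) i ∩ U))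
    (hinj : InjOn h (RelCWComplex.cellFrontier (d + 1) i ∩ U)) :
    IsOpen (h '' (RelCWComplex.cellFrontier (d + 1) i ∩ U)) := by
  have hΦ : ContinuousOn (RelCWComplex.map (d + 1) i) (sphere 0 1) :=
    (RelCWComplex.continuousOn _ _).mono sphere_subset_closedBall
  obtain ⟨W, hW, hWU⟩ := continuousOn_iff'.1 hΦ U hU
  rw [inter_comm, inter_comm W] at hWU
  have hmaps : MapsTo (RelCWComplex.map (d + 1) i) (sphere 0 1 ∩ W)
      (RelCWComplex.cellFrontier (d + 1) i ∩ U) := by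
    rw [← hWU]
    exact fun x hx => ⟨⟨x, hx.1, rfl⟩, hx.2⟩
  convert isOpen_image_sphere_of_continuousOn_injOn (h := h ∘ RelCWComplex.map (d + 1) i) hW
    (hh.comp (hΦ.mono inter_subset_left) hmaps)
    (hinj.comp ((hK.injOn_map _ i).mono (inter_subset_left.trans sphere_subset_closedBall))
      hmaps) using 1
  rw [image_comp, ← hWU, RelCWComplex.cellFrontier, image_inter_preimage]

instance [CWComplex.Finite K] : Finite (Cell K) :=
  have := RelCWComplex.finite_cells_of_finite (C := K)
  Finite.of_injective (fun x : Cell K => (⟨x.dim, x.idx⟩ : Σ n, RelCWComplex.cell K n))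
    fun x y h => by
      obtain ⟨n, i⟩ := x
      obtain ⟨m, j⟩ := y
      simp only [Sigma.mk.injEq] at h
      obtain ⟨rfl, h⟩ := h
      rw [eq_of_heq h]

variable [T2Space X]

/-- A nonempty open part of the boundary sphere of a cell is not contained in a cell of smaller
dimension. -/
lemma IsRegular.cellFrontier_inter_eq_empty (hK : IsRegular K) {d : ℕ}
    (i : RelCWComplex.cell K (d + 1)) {U : Set X} (hU : IsOpen U) {e : Cell K} (he : e.dim < d)
    (h : RelCWComplex.cellFrontier (d + 1) i ∩ U ⊆ e.closed) :
    RelCWComplex.cellFrontier (d + 1) i ∩ U = ∅ := by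
  obtain ⟨ψ, hψ, hψ'⟩ := hK.exists_chart e.dim e.idx
  let pad : (Fin e.dim → ℝ) → (Fin d → ℝ) := fun y k => if hk : k.1 < e.dim then y ⟨k, hk⟩ else 0
  have hpadc : Continuous pad := by
    refine continuous_pi fun k => ?_
    by_cases hk : k.1 < e.dim
    · simpa [pad, hk] using continuous_apply _
    · simpa [pad, hk] using continuous_const
  have hpadi : Function.Injective pad := by
    intro y y' hy
    ext k
    simpa [pad] using congrFun hy ⟨k, k.2.trans he⟩
  have hψi : InjOn ψ e.closed := by
    rintro _ ⟨x, hx, rfl⟩ _ ⟨y, hy, rfl⟩ hxy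
    rw [hψ' x hx, hψ' y hy] at hxy
    rw [hxy]
  have hopen := hK.isOpen_image_cellFrontier i hU (h := pad ∘ ψ)
    (hpadc.comp_continuousOn (hψ.mono h)) (hpadi.comp_injOn (hψi.mono h))
  have hopen' := isOpenMap_eval (⟨e.dim, he⟩ : Fin d) _ hopen
  rw [eq_empty_iff_forall_notMem]
  intro p hp
  refine not_isOpen_singleton (0 : ℝ) ?_
  convert hopen' using 1
  ext s
  constructor
  · rintro rfl
    exact ⟨_, ⟨p, hp, rfl⟩, by simp [pad]⟩
  · rintro ⟨_, ⟨q, hq, rfl⟩, rfl⟩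
    simp [pad]

lemma IsRegular.cellFrontier_inter_eq_empty_of_finite (hK : IsRegular K) {d : ℕ}
    (i : RelCWComplex.cell K (d + 1)) {s : Set (Cell K)} (hs : s.Finite)
    (hd : ∀ e ∈ s, e.dim < d) {U : Set X} (hU : IsOpen U)
    (h : RelCWComplex.cellFrontier (d + 1) i ∩ U ⊆ ⋃ e ∈ s, e.closed) :
    RelCWComplex.cellFrontier (d + 1) i ∩ U = ∅ := by
  induction s, hs using Set.Finite.induction_on generalizing U with
  | empty => simpa using h
  | @insert e s _ _ ih =>
    have h0 := ih (fun e he => hd e (mem_insert_of_mem _ he))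
      (hU.inter (RelCWComplex.isClosed_closedCell (n := e.dim) (i := e.idx)).isOpen_compl)
      (fun p hp => by
        have := h ⟨hp.1, hp.2.1⟩
        rw [biUnion_insert] at this
        exact this.resolve_left hp.2.2)
    refine hK.cellFrontier_inter_eq_empty i hU (hd e (mem_insert _ _)) fun p hp => ?_
    by_contra hpe
    exact (eq_empty_iff_forall_notMem.1 h0 p) ⟨hp.1, hp.2, hpe⟩

lemma IsRegular.cellFrontier_inter_subset_openCell (hK : IsRegular K) {d : ℕ}
    (i : RelCWComplex.cell K (d + 1)) (j : RelCWComplex.cell K d) {U : Set X} (hU : IsOpen U)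
    (h : RelCWComplex.cellFrontier (d + 1) i ∩ U ⊆ RelCWComplex.closedCell d j) :
    RelCWComplex.cellFrontier (d + 1) i ∩ U ⊆ RelCWComplex.openCell d j := by
  obtain ⟨ψ, hψ, hψ'⟩ := hK.exists_chart d j
  have hopen := hK.isOpen_image_cellFrontier i hU (hψ.mono h) (by
    intro p hp q hq hpq
    obtain ⟨x, hx, rfl⟩ := h hp
    obtain ⟨y, hy, rfl⟩ := h hq
    rw [hψ' x hx, hψ' y hy] at hpq
    rw [hpq])
  have hsub : ψ '' (RelCWComplex.cellFrontier (d + 1) i ∩ U) ⊆ closedBall 0 1 := by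
    rintro _ ⟨p, hp, rfl⟩
    obtain ⟨x, hx, rfl⟩ := h hp
    rwa [hψ' x hx]
  have hball := interior_maximal hsub hopen
  rw [interior_closedBall _ one_ne_zero] at hball
  intro p hp
  obtain ⟨x, hx, rfl⟩ := h hp
  have := hball ⟨_, hp, rfl⟩
  rw [hψ' x hx] at this
  exact ⟨x, this, rfl⟩

lemma isOpen_compl_biUnion_closed [CWComplex.Finite K] (s : Set (Cell K)) :
    IsOpen (⋃ e ∈ s, e.closed)ᶜ :=
  ((toFinite s).isClosed_biUnion fun e _ =>
    RelCWComplex.isClosed_closedCell (n := e.dim) (i := e.idx)).isOpen_compl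

/-- The boundary of a cell contains every cell of codimension one whose interior it meets. -/
lemma IsRegular.closedCell_subset_cellFrontier [CWComplex.Finite K] (hK : IsRegular K) {d : ℕ}
    (i : RelCWComplex.cell K (d + 1)) (j : RelCWComplex.cell K d)
    (h : (RelCWComplex.openCell d j ∩ RelCWComplex.cellFrontier (d + 1) i).Nonempty) :
    RelCWComplex.closedCell d j ⊆ RelCWComplex.cellFrontier (d + 1) i := by
  obtain ⟨ψ, hψ, hψ'⟩ := hK.exists_chart d j
  let U : Set X := (⋃ e ∈ {e : Cell K | e.dim ≤ d ∧ e ≠ ⟨d, j⟩}, e.closed)ᶜ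
  have hU : IsOpen U := isOpen_compl_biUnion_closed _
  have hUj : RelCWComplex.cellFrontier (d + 1) i ∩ U ⊆ RelCWComplex.openCell d j := by
    intro p hp
    obtain ⟨x, hlt, hx⟩ := Cell.exists_mem_openCell_of_mem_cellFrontier (y := ⟨d + 1, i⟩) hp.1
    by_cases hxj : x = ⟨d, j⟩
    · subst hxj
      exact hx
    · exact absurd (mem_biUnion (show x ∈ {e : Cell K | e.dim ≤ d ∧ e ≠ ⟨d, j⟩} from
        ⟨Nat.lt_succ_iff.1 hlt, hxj⟩) (RelCWComplex.openCell_subset_closedCell _ _ hx)) hp.2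
  have hjU : RelCWComplex.openCell d j ⊆ U := by
    intro p hp hpU
    obtain ⟨e, ⟨hed, hej⟩, hpe⟩ := mem_iUnion₂.1 hpU
    rcases Cell.eq_or_dim_lt_of_mem (x := ⟨d, j⟩) hp hpe with h | h
    · exact hej h.symm
    · exact absurd hed (not_le.2 h)
  have hsub := hUj.trans (RelCWComplex.openCell_subset_closedCell d j)
  have hopen := hK.isOpen_image_cellFrontier i hU (hψ.mono hsub) (by
    intro p hp q hq hpq
    obtain ⟨x, hx, rfl⟩ := hsub hp
    obtain ⟨y, hy, rfl⟩ := hsub hq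
    rw [hψ' x hx, hψ' y hy] at hpq
    rw [hpq])
  let C : Set (Fin d → ℝ) :=
    closedBall 0 1 ∩ RelCWComplex.map d j ⁻¹' RelCWComplex.cellFrontier (d + 1) i
  have hC : IsClosed C := (RelCWComplex.continuousOn d j).preimage_isClosed_of_isClosed
    isClosed_closedBall RelCWComplex.isClosed_cellFrontier
  have hsubC : ψ '' (RelCWComplex.cellFrontier (d + 1) i ∩ U) ⊆ C := by
    rintro _ ⟨p, hp, rfl⟩
    obtain ⟨x, hx, rfl⟩ := hsub hp
    rw [hψ' x hx]
    exact ⟨hx, hp.1⟩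
  have hCsub : C ∩ ball 0 1 ⊆ ψ '' (RelCWComplex.cellFrontier (d + 1) i ∩ U) := by
    rintro x ⟨⟨hx, hxi⟩, hxb⟩
    exact ⟨_, ⟨hxi, hjU ⟨x, hxb, rfl⟩⟩, hψ' x hx⟩
  have hball := (convex_ball (0 : Fin d → ℝ) 1).isPreconnected.subset_of_closure_inter_subset hopen
    (by
      obtain ⟨_, ⟨x, hx, rfl⟩, hp⟩ := h
      exact ⟨x, hx, hCsub ⟨⟨ball_subset_closedBall hx, hp⟩, hx⟩⟩)
    (fun x hx => hCsub ⟨closure_minimal hsubC hC hx.1, hx.2⟩)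
  rw [← RelCWComplex.closure_openCell_eq_closedCell]
  refine closure_minimal ?_ RelCWComplex.isClosed_cellFrontier
  rintro _ ⟨x, hx, rfl⟩
  exact (hsubC (hball hx)).2

/-- The diamond property: an interval of codimension two has a second intermediate cell. -/
theorem IsRegular.exists_ne_between [CWComplex.Finite K] (hK : IsRegular K) {b m c : Cell K}
    (hbm : m.dim = b.dim + 1) (hmc : c.dim = m.dim + 1) (hb : b.closed ⊆ m.closed)
    (hm : m.closed ⊆ c.closed) :
    ∃ m' : Cell K, m' ≠ m ∧ m'.dim = m.dim ∧ b.closed ⊆ m'.closed ∧ m'.closed ⊆ c.closed := by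
  obtain ⟨n, k⟩ := b
  obtain ⟨_, j⟩ := m
  obtain ⟨_, i⟩ := c
  dsimp only at hbm hmc
  subst hbm hmc
  by_contra! hno
  set p := RelCWComplex.map n k 0
  have hpk : p ∈ RelCWComplex.openCell n k := RelCWComplex.map_zero_mem_openCell _ _
  have hmem : ∀ e : Cell K, n < e.dim → p ∈ e.closed →
      p ∈ RelCWComplex.cellFrontier e.dim e.idx := by
    intro e he hpe
    refine (Cell.mem_closed_iff.1 hpe).resolve_right fun hpo => ?_
    have := Cell.eq_of_mem_openCell (x := ⟨n, k⟩) hpk hpo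
    subst this
    exact lt_irrefl _ he
  have hpj : p ∈ (⟨n + 1, j⟩ : Cell K).closed :=
    hb (RelCWComplex.openCell_subset_closedCell _ _ hpk)
  have hpi : p ∈ RelCWComplex.cellFrontier (n + 1 + 1) i :=
    hmem ⟨n + 1 + 1, i⟩ (by dsimp only; omega) (hm hpj)
  have huniq : ∀ e : RelCWComplex.cell K (n + 1), p ∈ RelCWComplex.closedCell (n + 1) e →
      (RelCWComplex.openCell (n + 1) e ∩ RelCWComplex.cellFrontier (n + 1 + 1) i).Nonempty →
      (⟨n + 1, e⟩ : Cell K) = ⟨n + 1, j⟩ := by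
    intro e hpe hne
    by_contra hej
    have h1 := hK.closedCell_subset_cellFrontier i e hne
    have h2 := hK.closedCell_subset_cellFrontier e k
      ⟨p, hpk, hmem ⟨n + 1, e⟩ (Nat.lt_succ_self n) hpe⟩
    exact hno ⟨n + 1, e⟩ hej rfl
      (h2.trans (RelCWComplex.cellFrontier_subset_closedCell _ _))
      (h1.trans (RelCWComplex.cellFrontier_subset_closedCell _ _))
  let U : Set X := (⋃ e ∈ {e : Cell K | p ∉ e.closed}, e.closed)ᶜ
  have hU : IsOpen U := isOpen_compl_biUnion_closed _
  have hpU : p ∈ U := by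
    intro h
    obtain ⟨e, he, hpe⟩ := mem_iUnion₂.1 h
    exact he hpe
  have hempty := hK.cellFrontier_inter_eq_empty_of_finite i
    (toFinite {e : Cell K | e.dim < n + 1}) (fun e he => he)
    (hU.inter (RelCWComplex.isClosed_closedCell (n := n + 1) (i := j)).isOpen_compl) (by
      rintro q ⟨hqi, hqU, hqj⟩
      obtain ⟨x, hlt, hx⟩ := Cell.exists_mem_openCell_of_mem_cellFrontier
        (y := ⟨n + 1 + 1, i⟩) hqi
      have hqx : q ∈ x.closed := RelCWComplex.openCell_subset_closedCell _ _ hx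
      have hpx : p ∈ x.closed := by
        by_contra hpx
        exact hqU (mem_biUnion (show x ∈ {e : Cell K | p ∉ e.closed} from hpx) hqx)
      rcases (Nat.lt_succ_iff.1 hlt).lt_or_eq with h | h
      · exact mem_biUnion (show x ∈ {e : Cell K | e.dim < n + 1} from h) hqx
      · obtain ⟨_, e⟩ := x
        dsimp only at h
        subst h
        rw [huniq e hpx ⟨q, hx, hqi⟩] at hqx
        exact absurd hqx hqj)
  have hsub : RelCWComplex.cellFrontier (n + 1 + 1) i ∩ U ⊆ RelCWComplex.closedCell (n + 1) j := by
    intro q hq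
    by_contra hqj
    exact (eq_empty_iff_forall_notMem.1 hempty q) ⟨hq.1, hq.2, hqj⟩
  have hpo := hK.cellFrontier_inter_subset_openCell i j hU hsub ⟨hpi, hpU⟩
  exact notMem_openCell_of_mem_cellFrontier
    (hmem ⟨n + 1, j⟩ (Nat.lt_succ_self n) hpj) hpo

/-- A cell is not in two regular pairs, once as the upper and once as the lower cell. -/
lemma IsDiscreteMorse.not_isRegularPair_of_isRegularPair [CWComplex.Finite K] (hK : IsRegular K)
    {f : Cell K → ℝ} (hf : IsDiscreteMorse f) {x y z : Cell K} (hxy : IsRegularPair f x y) :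
    ¬ IsRegularPair f y z := by
  intro hyz
  obtain ⟨m, hne, hdim, hxm, hmz⟩ := hK.exists_ne_between hxy.1 hyz.1 hxy.2.1 hyz.2.1
  have hlt : f x < f m := by
    by_contra hge
    exact hne (hf.coface x ⟨hdim.trans hxy.1, hxm, not_lt.1 hge⟩ hxy)
  refine hne (hf.face z (show m ∈ _ from ⟨by rw [hdim]; exact hyz.1, hmz, ?_⟩) hyz)
  exact hyz.2.2.trans (hxy.2.2.trans hlt.le)

end DiscreteMorse

theorem mainTheorem4 {X : Type*} [TopologicalSpace X] [T2Space X] (K : Set X)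
    [Topology.CWComplex K] [Topology.CWComplex.Finite K] (hK : DiscreteMorse.IsRegular K)
    (f : DiscreteMorse.Cell K → ℝ) (hf : DiscreteMorse.IsDiscreteMorse f)
    (w z : DiscreteMorse.Flo f) (γ γ' : w ⟶ z) (hγ : γ ≤ γ')
    (τ : PLoc.Zigzag (DiscreteMorse.morseSystem f) w.obj.obj z.obj.obj)
    (hτ : DiscreteMorse.Represents τ γ) :
    ∃ g' : τ.ForwardMaps, τ.ForwardLE g' ∧ DiscreteMorse.Represents (τ.replaceForward g') γ' ∧
      ∀ g'' : τ.ForwardMaps, DiscreteMorse.Represents (τ.replaceForward g'') γ' → g'' = g' := by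
  obtain ⟨g', hle, hg'⟩ := PLoc.Zigzag.enlarges_of_le DiscreteMorse.split_of_comp_le
    (fun u u' hu _ => DiscreteMorse.eq_of_plus u u' hu) hγ τ hτ
  refine ⟨g', hle, hg', fun g'' hg'' => ?_⟩
  refine PLoc.Zigzag.eq_of_labels_eq
    (φ := fun x y (p : x ⟶ y) => DiscreteMorse.nonregularSteps f (DiscreteMorse.EntPath.cells p))
    (DiscreteMorse.eq_of_nonregularSteps_prefix hf fun _ _ _ =>
      hf.not_isRegularPair_of_isRegularPair hK) τ g'' g' ?_
  exact PLoc.Zigzag.labels_eq_of_cls_eq DiscreteMorse.nonregularSteps_comp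
    DiscreteMorse.nonregularSteps_of_plus (hg''.trans hg'.symm)
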